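/- **Setting.** Let $n\ge 1$, $\mathcal M=\{1,\dots,n\}$, and let $\mathcal H$ be a two-dimensional complex Hilbert space. An *ensemble* is a map $\rho$ from $\mathcal M$ to the positive semidefinite operators on $\mathcal H$ with $\sum_m \mathrm{Tr}\,\rho(m)=1$. A bar denotes the average over $\{1,\dots,n\}$. A *numbering* is a bijection $\mathbf n:\{1,\dots,n\}\to\mathcal M$. A *numbering-valued measurement* is a family $\pi(\mathbf n)\ge 0$ indexed by the numberings with $\sum_{\mathbf n}\pi(\mathbf n)=\mathbb 1$. For a cost function $\gamma:\{1,\dots,n\}\to\mathbb R$ put $$G^\gamma(\rho,\pi)=\sum_{t=1}^n\gamma(t)\sum_{\mathbf n}\mathrm{Tr}[\pi(\mathbf n)\rho(\mathbf n(t))].$$ A *sequential-instruments strategy* consists of finite-dimensional Hilbert spaces $\mathcal H_0=\mathcal H,\mathcal H_1,\dots,\mathcal H_n$ and, for each $t\in\{1,\dots,n\}$, completely positive maps $\iota_t(m)$ ($m\in\mathcal M$) from the operators on $\mathcal H_{t-1}$ to those on $\mathcal H_t$ such that $\sum_m\iota_t(m)$ is trace preserving. Its $t$-th query is correct with probability $$q(t)=\sum_{\mathbf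 m} \mathrm{Tr}\big[\iota_n(\mathbf m_n)\circ\dots\circ\iota_1(\mathbf m_1)\,\rho(\mathbf m_t)\big],$$ the sum being over those $\mathbf m\in\mathcal M^n$ with $\mathbf m_t\notin\{\mathbf m_1,\dots,\mathbf m_{t-1}\}$. The *minimum guesswork* $G^\gamma_{\min}(\rho)$ is the minimum of $\sum_t\gamma(t)q(t)$ over all such strategies that surely query the correct state, i.e. for which $q$ is a probability distribution ($\sum_t q(t)=1$). The function $\gamma$ is *balanced* if there is a permutation $\sigma_\gamma$ of $\{1,\dots,n\}$ with $\frac12(\gamma+\gamma\circ\sigma_\gamma^{-1})=\overline\gamma$. Put $E^\gamma_\rho(\mathbf n)=2\sum_{t}(\gamma(t)-\overline\gamma)\,\rho(\mathbf n(t))$ and, with $\Pi_-$ and $\Pi_0$ denoting the projectors on the negative and null parts of a Hermitian operator, $$\pi^\gamma_{\rho,\mathbf n^*}(\mathbf n)=\begin{cases}(\Pi_-+\tfrac12\Pi_0)\,E^\gamma_\rho(\mathbf n)&\text{if }\mathbf n\in\{\mathbf n^*,\mathbf n^*\circ\sigma_\gamma\},\\0&\text{otherwise.}\end{cases}$$ Fix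 an orthonormal basis $(\tau_k)_{k=1}^3$ of the traceless Hermitian operators on $\mathcal H$ for the Hilbert–Schmidt product, and let $\mathbf v(A)=(\mathrm{Tr}[A\tau_k])_{k=1}^3\in\mathbb R^3$. For $f:\mathcal M\to\mathbb R^3$ let $\mathrm{Gram}(f)_{ij}=f(i)\cdot f(j)$. A real $n\times n$ matrix $A$ is *benevolent* if it is symmetric and Toeplitz, $A_{m+1,1}$ is non-decreasing in $m\in\{1,\dots,\lfloor n/2\rfloor\}$, and $A_{n+1-m,1}\ge A_{m+1,1}$ for all $m\in\{1,\dots,\lfloor n/2\rfloor\}$. Let $\mathbf n_{\mathrm{bv}}$ be the numbering with $\mathbf n_{\mathrm{bv}}^{-1}(m)=2m-1$ if $m\le\lceil n/2\rceil$ and $\mathbf n_{\mathrm{bv}}^{-1}(m)=2(n+1-m)$ otherwise. **Statement.** Let $\gamma$ be balanced, with witness $\sigma_\gamma\ne\mathrm{id}$, and let $\rho$ be an ensemble with uniform prior, $\mathrm{Tr}\,\rho(m)=1/n$ for all $m$. Suppose that $-\mathrm{Gram}(\mathbf v\circ\rho)$ is permutationally equivalent to a benevolent matrix and that $m\mapsto\mathbf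 v(\overline\rho)\cdot\mathbf v(\rho(m))$ is constant. Let $\sigma_1,\sigma_2$ be any permutations such that $\gamma\circ\sigma_1$ is non-decreasing and $-\mathrm{Gram}(\mathbf v\circ\rho\circ\sigma_2)$ is benevolent, and put $\mathbf n^*=\sigma_2\circ\mathbf n_{\mathrm{bv}}\circ\sigma_1^{-1}$. Then $\pi^\gamma_{\rho,\mathbf n^*}$ is a numbering-valued measurement and it attains the minimum guesswork: $$G^\gamma_{\min}(\rho)=G^\gamma\big(\rho,\pi^\gamma_{\rho,\mathbf n^*}\big)$$ (both minima exist and coincide: $G^\gamma(\rho,\pi^\gamma_{\rho,\mathbf n^*})$ is also the minimum of $G^\gamma(\rho,\pi)$ over all numbering-valued measurements $\pi$). -/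

import Mathlib

universe u v

namespace Guesswork

/-- The space of (bounded linear) operators on `H`. -/
abbrev Op (H : Type u) [NormedAddCommGroup H] [InnerProductSpace ℂ H] : Type u := H →L[ℂ] H

/-- The trace of an operator on a finite-dimensional Hilbert space. -/
noncomputable def tr {H : Type u} [NormedAddCommGroup H] [InnerProductSpace ℂ H] (A : Op H) : ℂ :=
  LinearMap.trace ℂ H (A : H →ₗ[ℂ] H)

/-- The average of a function on `{1, …, n}`. -/
noncomputable def average {n : ℕ} {V : Type u} [AddCommGroup V] [Module ℝ V] (f : Fin n → V) : V :=
  (n : ℝ)⁻¹ • ∑ i, f i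

/-- Numberings of `{1, …, n}`: bijections from `{1, …, n}` (times) to `{1, …, n}` (states). -/
abbrev Numbering (n : ℕ) : Type := Equiv.Perm (Fin n)

section Ensembles

variable {n : ℕ} {H : Type u} [NormedAddCommGroup H] [InnerProductSpace ℂ H]

/-- `ρ` is an ensemble: positive semidefinite operators whose traces sum to one. -/
structure IsEnsemble (ρ : Fin n → Op H) : Prop where
  pos : ∀ m, (ρ m).IsPositive
  sum_trace : ∑ m, tr (ρ m) = 1

/-- `π` is a numbering-valued measurement: positive semidefinite operators, indexed by the
numberings, which sum to the identity. -/
structure IsNumberingMeasurement (π : Numbering n → Op H) : Prop where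
  pos : ∀ ν, (π ν).IsPositive
  sum_eq_one : ∑ ν, π ν = 1

/-- The probability that the `t`-th query is correct when the numbering is obtained from the
single measurement `π`. -/
noncomputable def queryProb (ρ : Fin n → Op H) (π : Numbering n → Op H) (t : Fin n) : ℝ :=
  ∑ ν : Numbering n, (tr (π ν * ρ (ν t))).re

/-- The guesswork of the single-measurement strategy `π` with cost function `γ`. -/
noncomputable def guesswork (γ : Fin n → ℝ) (ρ : Fin n → Op H) (π : Numbering n → Op H) : ℝ :=
  ∑ t, γ t * queryProb ρ π t

/-- All the values of the guesswork attained by single-measurement strategies. -/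
def measurementGuessworks (γ : Fin n → ℝ) (ρ : Fin n → Op H) : Set ℝ :=
  {g | ∃ π : Numbering n → Op H, IsNumberingMeasurement π ∧ guesswork γ ρ π = g}

/-- The effective operator `2 ∑ₜ (γ(t) - γ̄) ρ(n(t))`. -/
noncomputable def effectiveOp (γ : Fin n → ℝ) (ρ : Fin n → Op H) (ν : Numbering n) : Op H :=
  (2 : ℝ) • ∑ t, (γ t - average γ) • ρ (ν t)

end Ensembles

section Sequential

/-- A quantum instrument with outcomes in `M` from operators on `H` to operators on `K`:
completely positive maps whose sum is trace preserving. -/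
structure Instrument (M : Type) [Fintype M]
    (H : Type u) [NormedAddCommGroup H] [InnerProductSpace ℂ H] [CompleteSpace H]
    (K : Type v) [NormedAddCommGroup K] [InnerProductSpace ℂ K] [CompleteSpace K] where
  map : M → CompletelyPositiveMap (Op H) (Op K)
  trace_preserving : ∀ X : Op H, ∑ m, tr (map m X) = tr X

/-- A tuple of `k` instruments with outcomes in `M`, to be applied one after the other, the first
one to a system `H`; the later systems are arbitrary finite-dimensional Hilbert spaces. -/
inductive InstrumentSeq (M : Type) [Fintype M] : (k : ℕ) → (H : Type u) →
    [NormedAddCommGroup H] → [InnerProductSpace ℂ H] → [CompleteSpace H] → Type (u + 1)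
  | nil (H : Type u) [NormedAddCommGroup H] [InnerProductSpace ℂ H] [CompleteSpace H] :
      InstrumentSeq M 0 H
  | cons {k : ℕ} {H : Type u} [NormedAddCommGroup H] [InnerProductSpace ℂ H] [CompleteSpace H]
      (K : Type u) [NormedAddCommGroup K] [InnerProductSpace ℂ K] [CompleteSpace K]
      [FiniteDimensional ℂ K] (ι : Instrument M H K) (rest : InstrumentSeq M k K) :
      InstrumentSeq M (k + 1) H

/-- `Tr[ι_k(m_k) ∘ ⋯ ∘ ι_1(m_1) X]`, the (unnormalized) probability that the instruments return the
outcomes `m_1, …, m_k` on the input `X`. -/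
noncomputable def InstrumentSeq.outcomeTrace {M : Type} [Fintype M] : {k : ℕ} → {H : Type u} →
    [NormedAddCommGroup H] → [InnerProductSpace ℂ H] → [CompleteSpace H] →
    InstrumentSeq M k H → (Fin k → M) → Op H → ℂ
  | _, _, _, _, _, @InstrumentSeq.nil _ _ _ _ _ _, _, X => tr X
  | _, _, _, _, _, @InstrumentSeq.cons _ _ _ _ _ _ _ _ _ _ _ _ ι rest, m, X => rest.outcomeTrace (Fin.tail m) (ι.map (m 0) X)

variable {n : ℕ} {H : Type u} [NormedAddCommGroup H] [InnerProductSpace ℂ H] [CompleteSpace H]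

open Classical in
/-- The probability that the outcomes are `m` and that the `t`-th query is the correct one; it
vanishes if the state `m t` has been queried before. -/
noncomputable def seqJointProb (ρ : Fin n → Op H) (S : InstrumentSeq (Fin n) n H)
    (m : Fin n → Fin n) (t : Fin n) : ℝ :=
  if ∃ s < t, m s = m t then 0 else (S.outcomeTrace m (ρ (m t))).re

/-- The probability that the `t`-th query of the sequential strategy is the correct one. -/
noncomputable def seqQueryProb (ρ : Fin n → Op H) (S : InstrumentSeq (Fin n) n H) (t : Fin n) : ℝ :=
  ∑ m : Fin n → Fin n, seqJointProb ρ S m t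

/-- The guesswork of a sequential-instruments strategy with cost function `γ`. -/
noncomputable def seqGuesswork (γ : Fin n → ℝ) (ρ : Fin n → Op H)
    (S : InstrumentSeq (Fin n) n H) : ℝ :=
  ∑ t, γ t * seqQueryProb ρ S t

/-- All the values of the guesswork attained by sequential-instruments strategies that surely query
the correct state, i.e. for which `seqQueryProb ρ S` is a probability distribution on
`{1, …, n}`. -/
def sequentialGuessworks (γ : Fin n → ℝ) (ρ : Fin n → Op H) : Set ℝ :=
  {g | ∃ S : InstrumentSeq (Fin n) n H, ∑ t, seqQueryProb ρ S t = 1 ∧ seqGuesswork γ ρ S = g}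

/-- `g` is the minimum guesswork: the minimum, over all sequential-instruments strategies, of the
expected cost. -/
def IsMinGuesswork (γ : Fin n → ℝ) (ρ : Fin n → Op H) (g : ℝ) : Prop :=
  IsLeast (sequentialGuessworks γ ρ) g

end Sequential

/-- `σ` witnesses that the cost function `γ` is balanced: `(γ + γ ∘ σ⁻¹) / 2 = γ̄`. -/
def IsBalancedBy {n : ℕ} (γ : Fin n → ℝ) (σ : Equiv.Perm (Fin n)) : Prop :=
  ∀ t, (γ t + γ (σ⁻¹ t)) / 2 = average γ

section Helstrom

variable {n : ℕ} {H : Type u} [NormedAddCommGroup H] [InnerProductSpace ℂ H] [CompleteSpace H]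

/-- The projector on the negative part of a self-adjoint operator. -/
noncomputable def negProj (A : Op H) : Op H := cfc (fun x : ℝ => if x < 0 then 1 else 0) A

/-- The projector on the null part of a self-adjoint operator. -/
noncomputable def nullProj (A : Op H) : Op H := cfc (fun x : ℝ => if x = 0 then 1 else 0) A

open Classical in
/-- The two-outcome measurement with outcomes `νs` and `νs ∘ σ`. -/
noncomputable def helstromMeasurement (γ : Fin n → ℝ) (σ : Equiv.Perm (Fin n)) (ρ : Fin n → Op H)
    (νs : Numbering n) (ν : Numbering n) : Op H :=
  if ν = νs ∨ ν = νs * σ then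
    negProj (effectiveOp γ ρ ν) + (1 / 2 : ℝ) • nullProj (effectiveOp γ ρ ν)
  else 0

end Helstrom

section Qubit

variable {H : Type u} [NormedAddCommGroup H] [InnerProductSpace ℂ H] [CompleteSpace H]

/-- Three traceless Hermitian operators that are orthonormal for the Hilbert-Schmidt product. For a
two-dimensional `H`, the traceless Hermitian operators form a real space of dimension three, so that
such a family is an orthonormal basis of it. -/
structure IsPauliBasis (τ : Fin 3 → Op H) : Prop where
  selfAdjoint : ∀ k, IsSelfAdjoint (τ k)
  traceless : ∀ k, tr (τ k) = 0
  orthonormal : ∀ j k, tr (τ j * τ k) = if j = k then 1 else 0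

/-- The Pauli vector of an operator with respect to `τ`. -/
noncomputable def pauliVector (τ : Fin 3 → Op H) (A : Op H) : EuclideanSpace ℝ (Fin 3) :=
  WithLp.toLp 2 fun k => (tr (A * τ k)).re

end Qubit

/-- Benevolent matrices. Indices start from `0` here, so that the row `i` below is the row `i + 1`
when indices start from `1`. -/
structure IsBenevolent {n : ℕ} (A : Matrix (Fin n) (Fin n) ℝ) : Prop where
  symm : A.IsSymm
  toeplitz : ∀ i j i' j' : Fin n, (i : ℤ) - j = i' - j' → A i j = A i' j'
  monotone : ∀ z i j : Fin n, (z : ℕ) = 0 → 1 ≤ (i : ℕ) → i ≤ j → (j : ℕ) ≤ n / 2 → A i z ≤ A j z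
  majorize : ∀ z i j : Fin n, (z : ℕ) = 0 → 1 ≤ (i : ℕ) → (i : ℕ) ≤ n / 2 → (i : ℕ) + j = n →
    A i z ≤ A j z

/-- The numbering whose inverse is, with indices starting from `1`, `m ↦ 2 m - 1` for `m ≤ ⌈n / 2⌉`
and `m ↦ 2 (n + 1 - m)` otherwise. Indices start from `0` here. -/
def bvNumbering (n : ℕ) : Numbering n where
  toFun t := if h : (t : ℕ) % 2 = 0 then ⟨t / 2, by omega⟩ else ⟨n - (t + 1) / 2, by omega⟩
  invFun m := if h : (m : ℕ) < (n + 1) / 2 then ⟨2 * m, by omega⟩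
    else ⟨2 * (n - m) - 1, by omega⟩
  left_inv t := by
    by_cases h : (t : ℕ) % 2 = 0
    · have h2 : (t : ℕ) / 2 < (n + 1) / 2 := by omega
      ext
      simp only [h, h2, dif_pos]
      omega
    · have h2 : ¬ n - ((t : ℕ) + 1) / 2 < (n + 1) / 2 := by omega
      ext
      simp only [h, h2, dif_neg, not_false_eq_true]
      omega
  right_inv m := by
    by_cases h : (m : ℕ) < (n + 1) / 2
    · have h2 : (2 * (m : ℕ)) % 2 = 0 := by omega
      ext
      simp only [h, h2, dif_pos]
      omega
    · have h2 : ¬ (2 * (n - (m : ℕ)) - 1) % 2 = 0 := by omega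
      ext
      simp only [h, h2, dif_neg, not_false_eq_true]
      omega

end Guesswork

/-! Write `E ν` for `effectiveOp γ ρ ν`. The guesswork of a measurement `π` is `γ̄ + ½ ∑ Re Tr[π ν *
E ν]`, because the total state does not depend on the order of the queries. On a qubit the uniform
prior makes `E ν` traceless, so it squares to `l ν ^ 2 • 1` with `l ν` equal to the length of its
Pauli vector divided by `√2`. Hence `E ν ≥ -l ν`, and no measurement goes below `γ̄ - max l`. As `γ`
is balanced, `E (ν * σ) = -E ν`; the Helstrom effects of `E ν` and `-E ν` therefore sum to the
identity, and at a maximizer `ν` of `l` they reach the bound (`guesswork_helstromMeasurement`).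
Maximizing `l` means maximizing a quadratic form in the centered costs, with the Gram matrix as
kernel, over all assignments of costs to states. Toeplitz structure and constant row sums make the
kernel circulant, and benevolence makes it decreasing in the distance on a circle. The optimum then
follows from a Riesz-type rearrangement inequality (`circular_rearrangement`), proved by two-point
symmetrization: large costs gather in an arc. Sequential strategies gain nothing. Their outcome
probabilities are positive functionals summing to the trace, and sureness lets each outcome string
be completed to a numbering, so the same operator bound applies. Conversely, a measurement is
carried out by instruments through a Naimark dilation. -/

namespace Guesswork

/-! ### Rearrangement on the discrete circle by two-point symmetrization -/

section Rearrangement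

variable {n : ℕ}

/-- The distance of two points of the discrete circle `Fin n`. -/
def cyclicDist (x y : Fin n) : ℕ :=
  min (((x : ℕ) - y) + (y - x)) (n - (((x : ℕ) - y) + (y - x)))

theorem cyclicDist_comm (x y : Fin n) : cyclicDist x y = cyclicDist y x := by
  simp only [cyclicDist, add_comm]

/-- A permutation of `Fin n` which is a reflection of the discrete circle. -/
def IsReflection (R : Equiv.Perm (Fin n)) : Prop :=
  ∃ c : ℕ, c < n ∧ ∀ x, ((R x : ℕ) + x = c ∨ (R x : ℕ) + x = c + n)

theorem exists_isReflection (x y : Fin n) : ∃ R : Equiv.Perm (Fin n), IsReflection R ∧ R x = y := by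
  have : NeZero n := ⟨by have := x.isLt; omega⟩
  refine ⟨Equiv.subLeft (x + y), ⟨(x + y : Fin n), (x + y).isLt, fun z => ?_⟩, by simp⟩
  rw [Equiv.subLeft_apply, Fin.sub_def]
  have h1 := (x + y).isLt
  have h2 := z.isLt
  generalize ((x + y : Fin n) : ℕ) = c at *
  simp only
  rcases le_or_gt (z : ℕ) c with h | h
  · rw [show n - (z : ℕ) + c = c - z + n by omega, Nat.add_mod_right, Nat.mod_eq_of_lt (by omega)]
    omega
  · rw [Nat.mod_eq_of_lt (by omega)]
    omega

theorem IsReflection.involutive {R : Equiv.Perm (Fin n)} (hR : IsReflection R) (x : Fin n) :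
    R (R x) = x := by
  obtain ⟨c, hc, h⟩ := hR
  ext
  have h1 := h x
  have h2 := h (R x)
  have := (R x).isLt
  have := (R (R x)).isLt
  omega

theorem IsReflection.cyclicDist_apply {R : Equiv.Perm (Fin n)} (hR : IsReflection R)
    (x y : Fin n) : cyclicDist (R x) (R y) = cyclicDist x y := by
  obtain ⟨c, hc, h⟩ := hR
  have h1 := h x
  have h2 := h y
  have := (R x).isLt
  have := (R y).isLt
  have := x.isLt
  have := y.isLt
  unfold cyclicDist
  omega

theorem val_bvNumbering_symm (x : Fin n) :
    (((bvNumbering n)⁻¹ x : Fin n) : ℕ) =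
      if (x : ℕ) < (n + 1) / 2 then 2 * (x : ℕ) else 2 * (n - x) - 1 := by
  change (((bvNumbering n).invFun x : Fin n) : ℕ) = _
  simp only [bvNumbering]
  split_ifs <;> rfl

/-- The inverse of `bvNumbering n` ranks the points as `0, n - 1, 1, n - 2, …`. So, whatever the
reflection, the points ranked above their mirror image lie in the open arc from `c / 2` to `(c + n)
/ 2`: all on the same side of the axis. -/
theorem lt_or_gt_of_bvNumbering_symm_lt {c : ℕ} (hc : c < n) {x x' : Fin n}
    (h : (x' : ℕ) + x = c ∨ (x' : ℕ) + x = c + n)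
    (hx : (bvNumbering n)⁻¹ x' < (bvNumbering n)⁻¹ x) :
    ((x' : ℕ) + x = c ∧ (x' : ℕ) < x) ∨ ((x' : ℕ) + x = c + n ∧ (x : ℕ) < x') := by
  rw [Fin.lt_def, val_bvNumbering_symm, val_bvNumbering_symm] at hx
  have := x.isLt
  have := x'.isLt
  split_ifs at hx <;> omega

/-- Two points on the same side of a reflection are closer than a point and a reflected point. -/
theorem IsReflection.cyclicDist_le {R : Equiv.Perm (Fin n)} (hR : IsReflection R) (x y : Fin n)
    (hx : (bvNumbering n)⁻¹ (R x) < (bvNumbering n)⁻¹ x)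
    (hy : (bvNumbering n)⁻¹ (R y) < (bvNumbering n)⁻¹ y) :
    cyclicDist x y ≤ cyclicDist (R x) y := by
  obtain ⟨c, hc, h⟩ := hR
  have h1 := lt_or_gt_of_bvNumbering_symm_lt hc (h x) hx
  have h2 := lt_or_gt_of_bvNumbering_symm_lt hc (h y) hy
  have h3 := (R x).isLt
  have h4 := (R y).isLt
  have h5 := x.isLt
  have h6 := y.isLt
  clear hx hy h
  unfold cyclicDist
  generalize (R x : ℕ) = x' at *
  generalize (R y : ℕ) = y' at *
  generalize (x : ℕ) = x at *
  generalize (y : ℕ) = y at *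
  refine (min_le_left _ _).trans (le_min ?_ ?_)
  · rcases h1 with ⟨h1, h1'⟩ | ⟨h1, h1'⟩ <;> rcases h2 with ⟨h2, h2'⟩ | ⟨h2, h2'⟩ <;> omega
  · rcases h1 with ⟨h1, h1'⟩ | ⟨h1, h1'⟩ <;> rcases h2 with ⟨h2, h2'⟩ | ⟨h2, h2'⟩ <;> omega

/-- A quadratic form in terms of its symmetric and antisymmetric parts under a reflection. -/
theorem quadratic_eq_symm_add_antisymm {ι : Type*} [Fintype ι] (R : Equiv.Perm ι)
    (hRR : ∀ x, R (R x) = x) (h : ι → ι → ℝ) (hR : ∀ x y, h (R x) (R y) = h x y) (a : ι → ℝ) :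
    8 * ∑ x, ∑ y, a x * a y * h x y =
      2 * ∑ x, ∑ y, (a x + a (R x)) * (a y + a (R y)) * h x y +
        ∑ x, ∑ y, (a x - a (R x)) * (a y - a (R y)) * (h x y - h (R x) y) := by
  have refl₂ : ∀ F : ι → ι → ℝ, ∑ x, ∑ y, F (R x) (R y) = ∑ x, ∑ y, F x y := fun F => by
    rw [← Equiv.sum_comp R fun x => ∑ y, F x y]
    exact Finset.sum_congr rfl fun x _ => Equiv.sum_comp R (F (R x))
  have refl₁ : ∀ F : ι → ι → ℝ, ∑ x, ∑ y, F (R x) y = ∑ x, ∑ y, F x y := fun F =>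
    Equiv.sum_comp R fun x => ∑ y, F x y
  have e1 := refl₂ fun x y => a x * a y * h x y
  have e2 := refl₂ fun x y => a x * a (R y) * h x y
  -- The factor `a x - a (R x)` is odd under `R`, so the kernel `h (R x) y` contributes the opposite
  -- of `h x y`.
  have e3 := refl₁ fun x y => (a x - a (R x)) * (a y - a (R y)) * h x y
  simp only [hR, hRR] at e1 e2 e3
  simp only [mul_sub, Finset.sum_sub_distrib] at e3 ⊢
  simp only [mul_add, add_mul, sub_mul, Finset.sum_add_distrib, Finset.sum_sub_distrib] at e3 ⊢
  linarith

/-- Without inversions `u ∘ w⁻¹` would be a monotone permutation, hence the identity. -/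
theorem exists_inversion {u w : Equiv.Perm (Fin n)} (h : u ≠ w) :
    ∃ x y, w x < w y ∧ u y < u x := by
  by_contra! H
  apply h
  have hm : StrictMono (w.symm.trans u) := by
    intro i j hij
    have := H (w.symm i) (w.symm j) (by simpa using hij)
    refine lt_of_le_of_ne this fun h' => hij.ne ?_
    simpa using h'
  have hid := (Equiv.Perm.monotone_iff _).1 hm.monotone
  ext x
  have := Equiv.congr_fun hid (w x)
  simpa using congrArg Fin.val this

/-- Two-point rearrangement: `u` is replaced by `u ∘ R` wherever `u` and `w` are ordered differently
with respect to `R`. -/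
theorem exists_polarization (R : Equiv.Perm (Fin n)) (hRR : ∀ x, R (R x) = x)
    (u w : Equiv.Perm (Fin n)) : ∃ u' : Equiv.Perm (Fin n),
      (∀ x, (u' x = u x ∧ u' (R x) = u (R x)) ∨ (u' x = u (R x) ∧ u' (R x) = u x)) ∧
      (∀ x, w (R x) < w x → u' (R x) ≤ u' x) := by
  classical
  -- The points of the orbits on which `u` and `w` disagree. `P` is invariant under `R`, so
  -- exchanging the two points of these orbits is an involution.
  let P : Fin n → Prop := fun x =>
    (w x < w (R x) ∧ u (R x) < u x) ∨ (w (R x) < w x ∧ u x < u (R x))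
  have hP : ∀ x, P (R x) ↔ P x := fun x => by simp only [P, hRR]; tauto
  let s : Fin n → Fin n := fun x => if P x then R x else x
  have hs : Function.Involutive s := fun x => by
    by_cases h : P x
    · simp only [s, if_pos h, hP, hRR]
    · simp only [s, if_neg h]
  refine ⟨(hs.toPerm s).trans u, fun x => ?_, fun x hx => ?_⟩
  · by_cases h : P x
    · right; simp [s, h, hP, hRR]
    · left; simp [s, h, hP]
  · by_cases h : P x
    · have : u x < u (R x) := by
        rcases h with h | h
        · exact absurd hx h.1.not_gt
        · exact h.2
      simpa [s, h, hP, hRR] using this.le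
    · have : ¬ u x < u (R x) := fun h' => h (Or.inr ⟨hx, h'⟩)
      simpa [s, h, hP] using this

/-- Swapping values within orbits of `R` preserves the symmetric part of `g ∘ u` and the absolute
value of its antisymmetric part. After polarization the signs of the antisymmetric part match those
of the kernel `h x y - h (R x) y`, so every product becomes nonnegative. -/
theorem two_point_rearrangement (h : Fin n → Fin n → ℝ)
    (hh : ∀ x y x' y', cyclicDist x y ≤ cyclicDist x' y' → h x' y' ≤ h x y)
    {g : Fin n → ℝ} (hg : Monotone g) {R : Equiv.Perm (Fin n)} (hR : IsReflection R)
    (u u' : Equiv.Perm (Fin n))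
    (hswap : ∀ x, (u' x = u x ∧ u' (R x) = u (R x)) ∨ (u' x = u (R x) ∧ u' (R x) = u x))
    (hpol : ∀ x, (bvNumbering n)⁻¹ (R x) < (bvNumbering n)⁻¹ x → u' (R x) ≤ u' x) :
    ∑ x, ∑ y, g (u x) * g (u y) * h x y ≤ ∑ x, ∑ y, g (u' x) * g (u' y) * h x y := by
  have hhR : ∀ x y, h (R x) (R y) = h x y := fun x y =>
    le_antisymm (hh _ _ _ _ (hR.cyclicDist_apply x y).ge) (hh _ _ _ _ (hR.cyclicDist_apply x y).le)
  have e := quadratic_eq_symm_add_antisymm R hR.involutive h hhR (g ∘ u)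
  have e' := quadratic_eq_symm_add_antisymm R hR.involutive h hhR (g ∘ u')
  simp only [Function.comp_apply] at e e'
  have hs : ∀ x, g (u' x) + g (u' (R x)) = g (u x) + g (u (R x)) := fun x => by
    rcases hswap x with ⟨h1, h2⟩ | ⟨h1, h2⟩ <;> rw [h1, h2]
    exact add_comm _ _
  have habs : ∀ x, |g (u' x) - g (u' (R x))| = |g (u x) - g (u (R x))| := fun x => by
    rcases hswap x with ⟨h1, h2⟩ | ⟨h1, h2⟩ <;> rw [h1, h2]
    exact abs_sub_comm _ _
  have key : ∀ x y, (g (u x) - g (u (R x))) * (g (u y) - g (u (R y))) * (h x y - h (R x) y) ≤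
      (g (u' x) - g (u' (R x))) * (g (u' y) - g (u' (R y))) * (h x y - h (R x) y) := by
    intro x y
    refine (le_abs_self _).trans ?_
    rw [abs_mul, abs_mul, ← habs, ← habs, ← abs_mul, ← abs_mul]
    refine (abs_of_nonneg ?_).le
    have hpos : ∀ x, (bvNumbering n)⁻¹ (R x) < (bvNumbering n)⁻¹ x →
        0 ≤ g (u' x) - g (u' (R x)) := fun x hx => sub_nonneg.2 (hg (hpol x hx))
    have hneg : ∀ x, (bvNumbering n)⁻¹ x < (bvNumbering n)⁻¹ (R x) →
        g (u' x) - g (u' (R x)) ≤ 0 := fun x hx => by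
      have := hpos (R x) (by rwa [hR.involutive])
      rw [hR.involutive] at this
      linarith
    -- Each sign pattern reduces to `cyclicDist_le` after reflecting the points ranked below their
    -- images; equality means a fixed point of `R`, where the product vanishes.
    rcases lt_trichotomy ((bvNumbering n)⁻¹ (R x)) ((bvNumbering n)⁻¹ x) with hx | hx | hx
    · rcases lt_trichotomy ((bvNumbering n)⁻¹ (R y)) ((bvNumbering n)⁻¹ y) with hy | hy | hy
      · exact mul_nonneg (mul_nonneg (hpos x hx) (hpos y hy))
          (sub_nonneg.2 (hh _ _ _ _ (hR.cyclicDist_le x y hx hy)))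
      · rw [(Equiv.injective _) hy]; simp
      · have := hR.cyclicDist_le x (R y) hx (by rwa [hR.involutive])
        rw [hR.cyclicDist_apply, ← hR.cyclicDist_apply x, hR.involutive] at this
        exact mul_nonneg_of_nonpos_of_nonpos (mul_nonpos_of_nonneg_of_nonpos (hpos x hx) (hneg y hy))
          (sub_nonpos.2 (hh _ _ _ _ this))
    · rw [(Equiv.injective _) hx]; simp
    · rcases lt_trichotomy ((bvNumbering n)⁻¹ (R y)) ((bvNumbering n)⁻¹ y) with hy | hy | hy
      · have := hR.cyclicDist_le (R x) y (by rwa [hR.involutive]) hy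
        rw [hR.involutive] at this
        exact mul_nonneg_of_nonpos_of_nonpos (mul_nonpos_of_nonpos_of_nonneg (hneg x hx) (hpos y hy))
          (sub_nonpos.2 (hh _ _ _ _ this))
      · rw [(Equiv.injective _) hy]; simp
      · have := hR.cyclicDist_le (R x) (R y) (by rwa [hR.involutive]) (by rwa [hR.involutive])
        rw [hR.cyclicDist_apply, ← hR.cyclicDist_apply (R (R x)), hR.involutive,
          hR.involutive] at this
        exact mul_nonneg (mul_nonneg_of_nonpos_of_nonpos (hneg x hx) (hneg y hy))
          (sub_nonneg.2 (hh _ _ _ _ this))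
  have := Finset.sum_le_sum fun x (_ : x ∈ Finset.univ) =>
    Finset.sum_le_sum fun y (_ : y ∈ Finset.univ) => key x y
  simp only [hs] at e'
  linarith

/-- The rearrangement inequality on the discrete circle. -/
theorem circular_rearrangement (h : Fin n → Fin n → ℝ)
    (hh : ∀ x y x' y', cyclicDist x y ≤ cyclicDist x' y' → h x' y' ≤ h x y)
    {g : Fin n → ℝ} (hg : Monotone g) (u : Equiv.Perm (Fin n)) :
    ∑ x, ∑ y, g (u x) * g (u y) * h x y ≤
      ∑ x, ∑ y, g ((bvNumbering n)⁻¹ x) * g ((bvNumbering n)⁻¹ y) * h x y := by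
  classical
  set w := (bvNumbering n)⁻¹ with hw
  let Q : Equiv.Perm (Fin n) → ℝ := fun u => ∑ x, ∑ y, g (u x) * g (u y) * h x y
  obtain ⟨m, -, hm⟩ := Finset.exists_max_image Finset.univ Q ⟨1, Finset.mem_univ _⟩
  -- Among the maximizers of `Q`, take one most correlated with `w`. If it were not `w`, polarizing
  -- across the reflection that exchanges an inverted pair would keep it a maximizer and strictly
  -- increase the correlation.
  obtain ⟨m', hm', hmax⟩ := Finset.exists_max_image (Finset.univ.filter fun u => Q m ≤ Q u)
    (fun u => ∑ x, ((w x : ℕ) : ℝ) * ((u x : ℕ) : ℝ)) ⟨m, by simp⟩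
  simp only [Finset.mem_filter, Finset.mem_univ, true_and] at hm' hmax hm
  suffices m' = w by
    rw [this] at hm'
    exact (hm u trivial).trans hm'
  by_contra hne
  obtain ⟨p, q, hpq, hqp⟩ := exists_inversion hne
  obtain ⟨R, hR, hRp⟩ := exists_isReflection p q
  obtain ⟨u', hswap, hpol⟩ := exists_polarization R hR.involutive m' w
  have hQ := hmax u' (hm'.trans (two_point_rearrangement h hh hg hR m' u' hswap hpol))
  -- Doubling pairs every point with its mirror image, so that the comparison becomes the two-term
  -- rearrangement inequality on each orbit.
  have sumR : ∀ v : Equiv.Perm (Fin n), 2 * ∑ x, ((w x : ℕ) : ℝ) * ((v x : ℕ) : ℝ) =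
      ∑ x, (((w x : ℕ) : ℝ) * ((v x : ℕ) : ℝ) + ((w (R x) : ℕ) : ℝ) * ((v (R x) : ℕ) : ℝ)) := by
    intro v
    rw [Finset.sum_add_distrib, Equiv.sum_comp R fun x => ((w x : ℕ) : ℝ) * ((v x : ℕ) : ℝ)]
    ring
  refine absurd hQ (not_le.2 ?_)
  suffices 2 * ∑ x, ((w x : ℕ) : ℝ) * ((m' x : ℕ) : ℝ) <
      2 * ∑ x, ((w x : ℕ) : ℝ) * ((u' x : ℕ) : ℝ) by linarith
  rw [sumR, sumR]
  have cast_lt : ∀ {a b : Fin n}, a < b → ((a : ℕ) : ℝ) < ((b : ℕ) : ℝ) := fun h => by exact_mod_cast h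
  have cast_le : ∀ {a b : Fin n}, a ≤ b → ((a : ℕ) : ℝ) ≤ ((b : ℕ) : ℝ) := fun h => by exact_mod_cast h
  refine Finset.sum_lt_sum (fun x _ => ?_) ⟨p, Finset.mem_univ _, ?_⟩
  · rcases hswap x with ⟨h1, h2⟩ | ⟨h1, h2⟩
    · rw [h1, h2]
    · rcases lt_trichotomy (w (R x)) (w x) with hx | hx | hx
      · have h3 := hpol x hx
        rw [h1, h2] at h3 ⊢
        nlinarith [cast_lt hx, cast_le h3]
      · rw [w.injective hx] at h1
        rw [h1, h2, w.injective hx]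
      · have h3 := hpol (R x) (by rwa [hR.involutive])
        rw [hR.involutive, h1, h2] at h3
        rw [h1, h2]
        nlinarith [cast_lt hx, cast_le h3]
  · have h3 := hpol q (by rw [← hRp, hR.involutive, hRp]; exact hpq)
    rw [← hRp, hR.involutive, hRp] at h3
    have h4 := hswap p
    rw [hRp] at h4 ⊢
    rcases h4 with ⟨h1, h2⟩ | ⟨h1, h2⟩
    · rw [h1, h2] at h3
      exact absurd hqp h3.not_gt
    · rw [h1, h2]
      nlinarith [cast_lt hpq, cast_lt hqp]

end Rearrangement

/-! ### From Toeplitz to circulant matrices -/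

section Circulant

/-- Consecutive rows of a Toeplitz matrix are shifts of each other; all entries cancel in the
difference of their sums except the one entering and the one leaving. This wrap-around identity
makes the matrix circulant. -/
theorem toeplitz_apply_eq_of_row_sums_eq {k : ℕ} (G : Matrix (Fin (k + 1)) (Fin (k + 1)) ℝ)
    (hT : ∀ i j i' j' : Fin (k + 1), (i : ℤ) - j = i' - j' → G i j = G i' j')
    (hrow : ∀ i i', ∑ j, G i j = ∑ j, G i' j) (i : Fin k) :
    G i.succ 0 = G i.castSucc (Fin.last k) := by
  have h := hrow i.succ i.castSucc
  rw [Fin.sum_univ_succ, Fin.sum_univ_castSucc (fun j => G i.castSucc j)] at h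
  have : ∀ j : Fin k, G i.succ j.succ = G i.castSucc j.castSucc := fun j => hT _ _ _ _ (by simp)
  simp only [this] at h
  linarith

/-- A matrix with constant row sums, the opposite of which is benevolent, is a decreasing function
of the distance on the discrete circle. -/
theorem IsBenevolent.antitone_cyclicDist {n : ℕ} {G : Matrix (Fin n) (Fin n) ℝ}
    (hG : IsBenevolent (-G)) (hrow : ∀ i i', ∑ j, G i j = ∑ j, G i' j)
    (hdiag : ∀ x y, G x y ≤ G x x) (x y x' y' : Fin n)
    (hd : cyclicDist x y ≤ cyclicDist x' y') : G x' y' ≤ G x y := by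
  obtain _ | k := n
  · exact x.elim0
  have hT : ∀ i j i' j' : Fin (k + 1), (i : ℤ) - j = i' - j' → G i j = G i' j' :=
    fun i j i' j' h => neg_injective (hG.toeplitz i j i' j' h)
  have hS : ∀ i j, G i j = G j i := fun i j => neg_injective (hG.symm.apply j i)
  have hcirc := toeplitz_apply_eq_of_row_sums_eq G hT hrow
  have hlow : ∀ i j : Fin (k + 1), j ≤ i → ∀ d : Fin (k + 1), (d : ℕ) = cyclicDist i j →
      G i j = G d 0 := by
    intro i j hij d hd
    rw [Fin.le_def] at hij
    have hi := i.isLt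
    unfold cyclicDist at hd
    rcases le_total ((i : ℕ) - j) (k + 1 - ((i : ℕ) - j)) with h | h
    · exact hT _ _ _ _ (by simp only [Fin.val_zero]; omega)
    -- Beyond half a turn, the wrap-around identity and symmetry replace the difference `d` by `k +
    -- 1 - d`.
    · have h1 : (k - (i - j) : ℕ) < k := by omega
      have h2 := hcirc ⟨k - (i - j), h1⟩
      rw [hT d 0 (Fin.succ ⟨k - (i - j), h1⟩) 0 (by simp; omega), h2, hS i j]
      exact hT _ _ _ _ (by simp; omega)
  have hle : ∀ i j : Fin (k + 1), cyclicDist i j ≤ (k + 1) / 2 := fun i j => by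
    unfold cyclicDist; omega
  have hval : ∀ i j d : Fin (k + 1), (d : ℕ) = cyclicDist i j → G i j = G d 0 := by
    intro i j d hd
    rcases le_total j i with h | h
    · exact hlow i j h d hd
    · rw [hS]
      exact hlow j i h d (by rw [hd, cyclicDist_comm])
  have hlt : ∀ i j : Fin (k + 1), cyclicDist i j < k + 1 := fun i j => by
    unfold cyclicDist; omega
  rw [hval x y ⟨_, hlt x y⟩ rfl, hval x' y' ⟨_, hlt x' y'⟩ rfl]
  -- The monotonicity in benevolence starts off the diagonal; distance zero is covered by `hdiag`.
  rcases Nat.eq_zero_or_pos (cyclicDist x y) with h0 | h0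
  · have : (⟨cyclicDist x y, hlt x y⟩ : Fin (k + 1)) = 0 := Fin.ext h0
    rw [this, hS]
    exact hdiag _ _
  · have := hG.monotone 0 ⟨_, hlt x y⟩ ⟨_, hlt x' y'⟩ rfl h0 hd (hle x' y')
    simpa using this

end Circulant

/-! ### Traces and Pauli vectors of qubit operators -/

section Rank

variable {H : Type u} [NormedAddCommGroup H] [InnerProductSpace ℂ H]

theorem tr_add (A B : Op H) : tr (A + B) = tr A + tr B := by simp [tr]

theorem tr_sub (A B : Op H) : tr (A - B) = tr A - tr B := by simp [tr]

theorem tr_smul (c : ℂ) (A : Op H) : tr (c • A) = c * tr A := by simp [tr]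

theorem tr_real_smul (c : ℝ) (A : Op H) : tr (c • A) = c * tr A := by
  rw [← Complex.coe_smul, tr_smul]

theorem tr_sum {ι : Type*} (s : Finset ι) (A : ι → Op H) : tr (∑ i ∈ s, A i) = ∑ i ∈ s, tr (A i) := by
  simp [tr]

theorem tr_zero : tr (0 : Op H) = 0 := by simp [tr]

theorem tr_one [FiniteDimensional ℂ H] : tr (1 : Op H) = Module.finrank ℂ H :=
  LinearMap.trace_one ℂ H

theorem tr_mul_comm (A B : Op H) : tr (A * B) = tr (B * A) :=
  LinearMap.trace_mul_comm ℂ _ _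

theorem tr_nonneg_of_isPositive [FiniteDimensional ℂ H] {A : Op H} (hA : A.IsPositive) :
    0 ≤ (tr A).re :=
  (Complex.le_def.1 (LinearMap.IsPositive.trace_nonneg hA.toLinearMap)).1

variable [CompleteSpace H]

omit [CompleteSpace H] in
/-- A traceless operator on a two-dimensional space squares to a scalar. -/
theorem mul_self_eq_smul_one (hH : Module.finrank ℂ H = 2) {E : Op H} (hE : tr E = 0) :
    E * E = (tr (E * E) / 2) • (1 : Op H) := by
  have : FiniteDimensional ℂ H := Module.finite_of_finrank_eq_succ hH
  let b := Module.finBasisOfFinrankEq ℂ H hH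
  let M : Op H → Matrix (Fin 2) (Fin 2) ℂ := fun A => LinearMap.toMatrix b b (A : H →ₗ[ℂ] H)
  have hM : Function.Injective M :=
    (LinearMap.toMatrix b b).injective.comp ContinuousLinearMap.coe_injective
  have htr : ∀ A, tr A = (M A).trace := fun A => LinearMap.trace_eq_matrix_trace ℂ b _
  have hmul : ∀ A B, M (A * B) = M A * M B := fun A B => LinearMap.toMatrix_mul b _ _
  have hsmul : ∀ (c : ℂ), M (c • 1) = c • (1 : Matrix (Fin 2) (Fin 2) ℂ) := fun c => by
    have : M (c • 1) = LinearMap.toMatrix b b (c • LinearMap.id) := rfl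
    rw [this, map_smul, LinearMap.toMatrix_id]
  apply hM
  rw [htr, Matrix.trace_fin_two] at hE
  have h1 : M E 1 1 = - M E 0 0 := by linear_combination hE
  rw [hsmul, htr, hmul, Matrix.trace_fin_two]
  ext i j
  fin_cases i <;> fin_cases j <;>
    simp [Matrix.mul_apply, Fin.sum_univ_two, h1] <;> ring

variable {τ : Fin 3 → Op H}

/-- Completeness of a Pauli basis. -/
theorem IsPauliBasis.eq_sum (hH : Module.finrank ℂ H = 2) (hτ : IsPauliBasis τ) {E : Op H}
    (hE : tr E = 0) : E = ∑ k, tr (E * τ k) • τ k := by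
  have : FiniteDimensional ℂ H := Module.finite_of_finrank_eq_succ hH
  -- Adjoining the identity gives four orthogonal operators in a space of dimension four; traces
  -- against them read off the coefficients.
  let e : Fin 4 → Op H := Fin.cons 1 τ
  have hli : LinearIndependent ℂ e := by
    rw [Fintype.linearIndependent_iff]
    intro c hc
    rw [Fin.sum_univ_succ] at hc
    simp only [e, Fin.cons_zero, Fin.cons_succ] at hc
    have h0 : c 0 = 0 := by
      have := congrArg tr hc
      simpa [tr_add, tr_sum, tr_smul, hτ.traceless, tr_one, hH, tr_zero] using this
    have hs : ∀ k : Fin 3, c k.succ = 0 := fun k => by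
      have := congrArg (fun A => tr (A * τ k)) hc
      simpa [h0, Finset.sum_mul, tr_sum, tr_smul, hτ.orthonormal, tr_zero] using this
    intro i
    refine Fin.cases h0 hs i
  have hfin : Module.finrank ℂ (Op H) = 4 := by
    rw [← LinearEquiv.finrank_eq (LinearMap.toContinuousLinearMap (𝕜 := ℂ) (E := H) (F' := H)),
      Module.finrank_linearMap, hH]
  have hspan := hli.span_eq_top_of_card_eq_finrank' (by rw [hfin]; rfl)
  obtain ⟨c, hc⟩ := (Submodule.mem_span_range_iff_exists_fun ℂ).1
    (hspan ▸ Submodule.mem_top : E ∈ Submodule.span ℂ (Set.range e))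
  rw [Fin.sum_univ_succ] at hc
  simp only [e, Fin.cons_zero, Fin.cons_succ] at hc
  have h0 : c 0 = 0 := by
    have := congrArg tr hc
    rw [hE] at this
    simpa [tr_add, tr_sum, tr_smul, hτ.traceless, tr_one, hH] using this
  rw [h0, zero_smul, zero_add] at hc
  have hs : ∀ k : Fin 3, tr (E * τ k) = c k.succ := fun k => by
    rw [← hc]
    simp [Finset.sum_mul, tr_sum, tr_smul, hτ.orthonormal]
  simp only [hs, hc]

theorem tr_star [FiniteDimensional ℂ H] (A : Op H) : tr (star A) = star (tr A) := by
  unfold tr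
  rw [LinearMap.trace_eq_sum_inner _ (stdOrthonormalBasis ℂ H),
    LinearMap.trace_eq_sum_inner _ (stdOrthonormalBasis ℂ H), star_sum]
  refine Finset.sum_congr rfl fun i _ => ?_
  rw [ContinuousLinearMap.star_eq_adjoint]
  simp [ContinuousLinearMap.adjoint_inner_right]

theorem im_tr_mul_eq_zero [FiniteDimensional ℂ H] {A B : Op H} (hA : IsSelfAdjoint A)
    (hB : IsSelfAdjoint B) : (tr (A * B)).im = 0 := by
  rw [← Complex.conj_eq_iff_im]
  change star (tr (A * B)) = _
  rw [← tr_star, star_mul, hA.star_eq, hB.star_eq, tr_mul_comm]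

/-- Parseval's identity for the Pauli vector. -/
theorem IsPauliBasis.tr_mul_self (hH : Module.finrank ℂ H = 2) (hτ : IsPauliBasis τ) {E : Op H}
    (hE : tr E = 0) (hs : IsSelfAdjoint E) :
    tr (E * E) = ((‖pauliVector τ E‖ ^ 2 : ℝ) : ℂ) := by
  have : FiniteDimensional ℂ H := Module.finite_of_finrank_eq_succ hH
  conv_lhs => enter [1, 2]; rw [hτ.eq_sum hH hE]
  have : ∀ k, tr (E * τ k) = ((tr (E * τ k)).re : ℂ) := fun k =>
    Complex.ext rfl (by simp [im_tr_mul_eq_zero hs (hτ.selfAdjoint k)])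
  rw [EuclideanSpace.norm_sq_eq, Finset.mul_sum, tr_sum, Complex.ofReal_sum]
  refine Finset.sum_congr rfl fun k _ => ?_
  rw [mul_smul_comm, tr_smul, this k]
  simp [pauliVector, sq]

end Rank

/-! ### Helstrom effects -/

section HelstromProperties

variable {H : Type u} [NormedAddCommGroup H] [InnerProductSpace ℂ H] [CompleteSpace H]

/-- The Helstrom effect: the projector on the negative part plus half of that on the null part. -/
noncomputable def helstromEffect (A : Op H) : Op H := negProj A + (1 / 2 : ℝ) • nullProj A

omit [CompleteSpace H] in
theorem finite_spectrum_op [FiniteDimensional ℂ H] (A : Op H) : (spectrum ℝ A).Finite := by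
  rw [← spectrum.preimage_algebraMap (R := ℝ) ℂ]
  refine Set.Finite.preimage (FaithfulSMul.algebraMap_injective ℝ ℂ).injOn ?_
  rw [← AlgEquiv.spectrum_eq (Module.End.toContinuousLinearMap (𝕜 := ℂ) H).symm A]
  exact Module.End.finite_spectrum _

variable [FiniteDimensional ℂ H]

omit [CompleteSpace H] in
theorem continuousOn_spectrum_op (f : ℝ → ℝ) (A : Op H) : ContinuousOn f (spectrum ℝ A) :=
  (finite_spectrum_op A).continuousOn f

theorem helstromEffect_eq_cfc (A : Op H) :
    helstromEffect A =
      cfc (fun x : ℝ => (if x < 0 then 1 else 0) + (1 / 2 : ℝ) * (if x = 0 then 1 else 0)) A := by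
  rw [cfc_add (hf := continuousOn_spectrum_op _ _) (hg := continuousOn_spectrum_op _ _),
    cfc_const_mul (1 / 2 : ℝ) (fun x : ℝ => if x = 0 then 1 else 0) A
      (continuousOn_spectrum_op _ _)]
  rfl

theorem isPositive_helstromEffect (A : Op H) : (helstromEffect A).IsPositive := by
  rw [← ContinuousLinearMap.nonneg_iff_isPositive, helstromEffect_eq_cfc]
  refine cfc_nonneg fun x _ => ?_
  positivity

/-- The defining function satisfies `f x + f (-x) = 1` everywhere; at `x = 0` this is what the
weight one half is for. -/
theorem helstromEffect_add_neg {A : Op H} (hA : IsSelfAdjoint A) :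
    helstromEffect A + helstromEffect (-A) = 1 := by
  rw [helstromEffect_eq_cfc, helstromEffect_eq_cfc (-A),
    ← cfc_comp_neg (hf := ((finite_spectrum_op A).image _).continuousOn _),
    ← cfc_add (hf := continuousOn_spectrum_op _ _) (hg := continuousOn_spectrum_op _ _),
    ← cfc_one ℝ A]
  refine cfc_congr fun x _ => ?_
  rcases lt_trichotomy x 0 with h | h | h
  · simp [h, h.ne, h.le]
  · simp [h]; norm_num
  · simp [h, h.ne', h.le]

/-- The spectrum lies in `{l, -l}`, where the negative part `f x * x` agrees with the affine
function `(x - l) / 2`. -/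
theorem helstromEffect_mul {E : Op H} (hE : IsSelfAdjoint E) {l : ℝ} (hl : 0 ≤ l)
    (hE2 : E * E = (l ^ 2) • (1 : Op H)) :
    helstromEffect E * E = (1 / 2 : ℝ) • (E - l • (1 : Op H)) := by
  have hspec : ∀ x ∈ spectrum ℝ E, x = l ∨ x = -l := by
    intro x hx
    have h1 := spectrum.pow_mem_pow E 2 hx
    rw [sq E, hE2, ← Algebra.algebraMap_eq_smul_one] at h1
    have h2 : x ^ 2 = l ^ 2 := by
      by_contra hne
      refine (spectrum.notMem_iff.2 ?_) h1
      rw [← map_sub]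
      exact (IsUnit.mk0 _ (sub_ne_zero.2 hne)).map _
    exact sq_eq_sq_iff_eq_or_eq_neg.1 h2
  have hr : (1 / 2 : ℝ) • (E - l • (1 : Op H)) = cfc (fun x : ℝ => 1 / 2 * (x - l)) E := by
    rw [cfc_const_mul (1 / 2 : ℝ) (fun x : ℝ => x - l) E (continuousOn_spectrum_op _ _),
      cfc_sub (fun x : ℝ => x) (fun _ => l) E, cfc_id' ℝ E, cfc_const l E,
      Algebra.algebraMap_eq_smul_one]
  have hm := cfc_mul (fun x : ℝ => (if x < 0 then 1 else 0) + (1 / 2 : ℝ) * (if x = 0 then 1 else 0))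
    (fun x => x) E (continuousOn_spectrum_op _ _) (continuousOn_spectrum_op _ _)
  rw [cfc_id' ℝ E] at hm
  rw [hr, helstromEffect_eq_cfc, ← hm]
  refine cfc_congr fun x hx => ?_
  rcases hspec x hx with rfl | rfl
  · simp [hl.not_gt]
  · rcases hl.eq_or_lt with rfl | h
    · simp
    · simp [h, h.ne']; ring

omit [FiniteDimensional ℂ H] in
/-- A self-adjoint operator with square `l ^ 2` is bounded from below by `-l`. -/
theorem isPositive_smul_one_add {E : Op H} (hE : IsSelfAdjoint E) {l : ℝ} (hl : 0 ≤ l)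
    (hE2 : E * E = (l ^ 2) • (1 : Op H)) : (l • (1 : Op H) + E).IsPositive := by
  rw [← ContinuousLinearMap.nonneg_iff_isPositive]
  have hs : IsSelfAdjoint (l • (1 : Op H) + E) := by
    refine IsSelfAdjoint.add ?_ hE
    exact (IsSelfAdjoint.all l).smul (IsSelfAdjoint.one _)
  rcases hl.eq_or_lt with rfl | h
  · have : E = 0 := by
      rw [← CStarRing.star_mul_self_eq_zero_iff, hE.star_eq, hE2]
      simp
    simp [this]
  -- As `(l + E) ^ 2 = 2 l (l + E)`, the operator is a positive multiple of a square.
  · have hsq : l • (1 : Op H) + E =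
        (1 / (2 * l)) • (star (l • (1 : Op H) + E) * (l • (1 : Op H) + E)) := by
      rw [hs.star_eq]
      have : (l • (1 : Op H) + E) * (l • (1 : Op H) + E) = (2 * l) • (l • (1 : Op H) + E) := by
        rw [mul_add, add_mul, add_mul, hE2]
        simp only [smul_mul_assoc, mul_smul_comm, one_mul, mul_one, smul_smul, smul_add]
        rw [two_mul, add_smul, add_mul, add_smul, sq]
        abel
      rw [this, smul_smul, one_div, inv_mul_cancel₀ (by positivity), one_smul]
    rw [hsq]
    exact smul_nonneg (by positivity) (star_mul_self_nonneg _)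

end HelstromProperties

/-! ### From sequential strategies to positive functionals -/

section OutcomeFunctionals

/-- The outcome probabilities of a sequence of instruments are given by positive functionals which
sum to the trace. -/
theorem InstrumentSeq.exists_functional {M : Type} [Fintype M] {k : ℕ} {H : Type u}
    [NormedAddCommGroup H] [InnerProductSpace ℂ H] [CompleteSpace H] (hfin : FiniteDimensional ℂ H)
    (S : InstrumentSeq M k H) :
    ∃ φ : (Fin k → M) → (Op H →ₗ[ℂ] ℂ), (∀ m X, S.outcomeTrace m X = φ m X) ∧
      (∀ m X, X.IsPositive → 0 ≤ (φ m X).re) ∧ ∀ X, ∑ m, φ m X = tr X := by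
  induction S with
  | nil H =>
    refine ⟨fun _ => LinearMap.trace ℂ H ∘ₗ ContinuousLinearMap.coeLM ℂ, fun _ _ => rfl,
      fun _ _ hX => tr_nonneg_of_isPositive hX, fun X => ?_⟩
    simp [tr]
  | @cons k H _ _ _ K _ _ _ _ ι rest ih =>
    obtain ⟨φ, h1, h2, h3⟩ := ih inferInstance
    refine ⟨fun m => φ (Fin.tail m) ∘ₗ (ι.map (m 0)).toLinearMap, fun m X => h1 _ _,
      fun m X hX => h2 _ _ ?_, fun X => ?_⟩
    · rw [← ContinuousLinearMap.nonneg_iff_isPositive] at hX ⊢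
      exact map_nonneg (ι.map (m 0)) hX
    · rw [← ι.trace_preserving X, ← Equiv.sum_comp (Fin.consEquiv fun _ => M),
        Fintype.sum_prod_type]
      exact Finset.sum_congr rfl fun x _ => h3 (ι.map x X)

/-- A sequence of queries can be completed to a numbering by replacing the repeated queries. -/
theorem exists_numbering_eq_of_new {n : ℕ} (m : Fin n → Fin n) :
    ∃ ν : Numbering n, ∀ t, (¬ ∃ s < t, m s = m t) → ν t = m t := by
  classical
  obtain ⟨g, hg⟩ := Set.MapsTo.exists_equiv_extend_of_card_eq (t := (Finset.univ : Finset (Fin n)))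
    (s := {t | ¬ ∃ s < t, m s = m t}) (f := m) (by simp) (fun _ _ => by simp) (by
      intro a ha b hb hab
      rcases lt_trichotomy a b with h | h | h
      · exact absurd ⟨a, h, hab⟩ hb
      · exact h
      · exact absurd ⟨b, h, hab.symm⟩ ha)
  exact ⟨g.trans (Equiv.subtypeUnivEquiv fun _ => Finset.mem_univ _), fun t ht => hg t ht⟩

/-- A sequential strategy which surely queries the correct state is equivalent to a family of
positive functionals, each one with its numbering. -/
theorem exists_functional_numbering {n : ℕ} {H : Type u} [NormedAddCommGroup H]
    [InnerProductSpace ℂ H] [CompleteSpace H] [FiniteDimensional ℂ H] {ρ : Fin n → Op H}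
    (hρ : IsEnsemble ρ) (S : InstrumentSeq (Fin n) n H) (hS : ∑ t, seqQueryProb ρ S t = 1) :
    ∃ (φ : (Fin n → Fin n) → (Op H →ₗ[ℂ] ℂ)) (ν : (Fin n → Fin n) → Numbering n),
      (∀ m X, X.IsPositive → 0 ≤ (φ m X).re) ∧ (∀ X, ∑ m, φ m X = tr X) ∧
      ∀ γ : Fin n → ℝ, seqGuesswork γ ρ S = ∑ m, ∑ t, γ t * (φ m (ρ (ν m t))).re := by
  obtain ⟨φ, h1, h2, h3⟩ := S.exists_functional inferInstance
  choose ν hν using exists_numbering_eq_of_new (n := n)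
  refine ⟨φ, ν, h2, h3, fun γ => ?_⟩
  -- Replacing repeated queries can only add probability. The total is already one by sureness, so
  -- all these inequalities are equalities.
  have hle : ∀ m t, seqJointProb ρ S m t ≤ (φ m (ρ (ν m t))).re := by
    intro m t
    unfold seqJointProb
    split_ifs with h
    · exact h2 _ _ (hρ.pos _)
    · rw [hν m t h, h1]
  have htot : ∑ m, ∑ t, (φ m (ρ (ν m t))).re = 1 := by
    have : ∀ m, ∑ t, (φ m (ρ (ν m t))).re = (φ m (∑ j, ρ j)).re := fun m => by
      rw [Equiv.sum_comp (ν m) fun j => (φ m (ρ j)).re, map_sum, Complex.re_sum]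
    simp only [this]
    rw [← Complex.re_sum, h3, tr_sum, hρ.sum_trace, Complex.one_re]
  have heq : ∀ m t, seqJointProb ρ S m t = (φ m (ρ (ν m t))).re := by
    have hs : ∑ m, ∑ t, seqJointProb ρ S m t = ∑ m, ∑ t, (φ m (ρ (ν m t))).re := by
      rw [htot, Finset.sum_comm]
      exact hS
    have hs' := (Finset.sum_eq_sum_iff_of_le fun m _ => Finset.sum_le_sum fun t _ => hle m t).1 hs
    intro m t
    exact (Finset.sum_eq_sum_iff_of_le fun t _ => hle m t).1 (hs' m (Finset.mem_univ _)) t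
      (Finset.mem_univ _)
  simp only [seqGuesswork, seqQueryProb, Finset.mul_sum, heq]
  exact Finset.sum_comm

end OutcomeFunctionals

/-! ### Instruments from Kraus operators -/

section KrausInstruments

variable {H : Type u} [NormedAddCommGroup H] [InnerProductSpace ℂ H] [CompleteSpace H]
  {K : Type v} [NormedAddCommGroup K] [InnerProductSpace ℂ K] [CompleteSpace K]

open ContinuousLinearMap (adjoint)

/-- The linear map `X ↦ A X A†`. -/
noncomputable def conjLinear (A : H →L[ℂ] K) : Op H →ₗ[ℂ] Op K where
  toFun X := A ∘L X ∘L adjoint A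
  map_add' X Y := by ext; simp
  map_smul' c X := by ext; simp

/-- The completely positive map `X ↦ A X A†`, for an output space which contains an isometric copy
of the input space. -/
noncomputable def conjCompletelyPositive (J A : H →L[ℂ] K)
    (hJ : adjoint J ∘L J = ContinuousLinearMap.id ℂ H) :
    CompletelyPositiveMap (Op H) (Op K) where
  toLinearMap := conjLinear A
  map_cstarMatrix_nonneg' k M hM := by
    have hJ' : ∀ x, adjoint J (J x) = x := fun x => congrArg (fun f : H →L[ℂ] H => f x) hJ
    rw [StarOrderedRing.nonneg_iff] at hM
    induction hM using AddSubmonoid.closure_induction with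
    | mem M hM =>
      obtain ⟨N, rfl⟩ := hM
      have hof : ∀ i j, CStarMatrix.ofMatrix (fun i j => J ∘L N i j ∘L adjoint A) i j =
          J ∘L N i j ∘L adjoint A := fun _ _ => rfl
      -- Since `J† J = 1`, inserting it between the factors turns the entries of `N` into operators
      -- on `K` and exhibits the image as a square.
      have : ((star N * N).map (conjLinear A)) =
          star (CStarMatrix.ofMatrix fun i j => J ∘L N i j ∘L adjoint A) *
            CStarMatrix.ofMatrix fun i j => J ∘L N i j ∘L adjoint A := by
        ext i j x
        simp [CStarMatrix.mul_apply, CStarMatrix.star_apply, ContinuousLinearMap.star_eq_adjoint,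
          ContinuousLinearMap.adjoint_comp, hJ', conjLinear, hof]
      rw [this]
      exact star_mul_self_nonneg _
    | zero =>
      have : ((0 : CStarMatrix (Fin k) (Fin k) (Op H)).map (conjLinear A)) = 0 := by
        ext; simp
      rw [this]
    | add M N _ _ h1 h2 =>
      have : (M + N).map (conjLinear A) = M.map (conjLinear A) + N.map (conjLinear A) := by
        ext; simp
      rw [this]
      exact add_nonneg h1 h2

omit [CompleteSpace H] [CompleteSpace K] in
theorem tr_comp_comm [FiniteDimensional ℂ H] [FiniteDimensional ℂ K] (A : H →L[ℂ] K)
    (B : K →L[ℂ] H) : tr (A ∘L B) = tr (B ∘L A) :=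
  LinearMap.trace_comp_comm' (B : K →ₗ[ℂ] H) (A : H →ₗ[ℂ] K)

/-- Passage to the Heisenberg picture, in which the effect of successive instruments is computed
backwards. -/
theorem tr_conj_mul [FiniteDimensional ℂ H] [FiniteDimensional ℂ K] (A : H →L[ℂ] K) (X : Op H)
    (P : Op K) : tr (conjLinear A X * P) = tr (X * (adjoint A ∘L P ∘L A)) :=
  tr_comp_comm A (X ∘L adjoint A ∘L P)

/-- The instrument with Kraus operators `A`. -/
noncomputable def krausInstrument {M : Type} [Fintype M] [FiniteDimensional ℂ H]
    [FiniteDimensional ℂ K] (J : H →L[ℂ] K) (hJ : adjoint J ∘L J = ContinuousLinearMap.id ℂ H)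
    (A : M → (H →L[ℂ] K)) (hA : ∑ m, adjoint (A m) ∘L A m = 1) :
    Instrument M H K where
  map m := conjCompletelyPositive J (A m) hJ
  trace_preserving X := by
    have : ∀ m, tr (conjCompletelyPositive J (A m) hJ X) = tr (X * (adjoint (A m) ∘L A m)) :=
      fun m => tr_comp_comm (A m) (X ∘L adjoint (A m))
    simp only [this]
    rw [← tr_sum, ← Finset.mul_sum, hA, mul_one]

theorem outcomeTrace_cons_krausInstrument {H K : Type u} [NormedAddCommGroup H]
    [InnerProductSpace ℂ H] [CompleteSpace H] [NormedAddCommGroup K] [InnerProductSpace ℂ K]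
    [CompleteSpace K] {M : Type} [Fintype M] [FiniteDimensional ℂ H] [FiniteDimensional ℂ K]
    (J : H →L[ℂ] K) (hJ : adjoint J ∘L J = ContinuousLinearMap.id ℂ H)
    (A : M → (H →L[ℂ] K)) (hA : ∑ m, adjoint (A m) ∘L A m = 1) {k : ℕ} (S : InstrumentSeq M k K)
    (m : Fin (k + 1) → M) (X : Op H) :
    (InstrumentSeq.cons K (krausInstrument J hJ A hA) S).outcomeTrace m X =
      S.outcomeTrace (Fin.tail m) (conjLinear (A (m 0)) X) := rfl

end KrausInstruments

/-! ### Measurements as sequences of instruments, by Naimark dilation -/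

section MeasurementSeq

variable {ι : Type} [Fintype ι] {H : Type u} [NormedAddCommGroup H] [InnerProductSpace ℂ H]
  [CompleteSpace H]

open ContinuousLinearMap (adjoint)

open Classical in
/-- The projector of a direct sum on the summands whose index satisfies `p`. -/
noncomputable def blockProj (H : Type u) [NormedAddCommGroup H] [InnerProductSpace ℂ H]
    (p : ι → Prop) : Op (PiLp 2 fun _ : ι => H) :=
  (PiLp.continuousLinearEquiv 2 ℂ fun _ : ι => H).symm.toContinuousLinearMap ∘L
    ContinuousLinearMap.pi fun i => if p i then PiLp.proj 2 (fun _ : ι => H) i else 0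

omit [CompleteSpace H] in
open Classical in
theorem blockProj_apply (p : ι → Prop) (x : PiLp 2 fun _ : ι => H) (i : ι) :
    blockProj H p x i = if p i then x i else 0 := by
  simp only [blockProj]
  split_ifs with h <;> simp [h]

omit [CompleteSpace H] in
theorem blockProj_mul (p q : ι → Prop) :
    blockProj H p * blockProj H q = blockProj H fun i => p i ∧ q i := by
  classical
  ext x i
  change blockProj H p (blockProj H q x) i = _
  simp only [blockProj_apply]
  split_ifs <;> simp_all

omit [CompleteSpace H] in
theorem blockProj_true : blockProj H (fun _ : ι => True) = 1 := by
  ext x i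
  simp [blockProj_apply]

theorem adjoint_blockProj (p : ι → Prop) : adjoint (blockProj H p) = blockProj H p := by
  classical
  symm
  rw [ContinuousLinearMap.eq_adjoint_iff]
  intro x y
  simp only [PiLp.inner_apply, blockProj_apply]
  refine Finset.sum_congr rfl fun i _ => ?_
  split_ifs <;> simp

omit [CompleteSpace H] in
theorem sum_blockProj {M : Type} [Fintype M] (f : ι → M) :
    ∑ m, blockProj H (fun i => f i = m) = 1 := by
  classical
  ext x i
  simp [blockProj_apply]

variable [FiniteDimensional ℂ H]

/-- The sequence of the projective measurements of the functions `f t` of the summand. -/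
theorem exists_projectiveSeq {M : Type} [Fintype M] (k : ℕ) (f : Fin k → ι → M) :
    ∃ S : InstrumentSeq M k (PiLp 2 fun _ : ι => H), ∀ m X,
      S.outcomeTrace m X = tr (X * blockProj H fun i => ∀ t, f t i = m t) := by
  induction k with
  | zero =>
    refine ⟨.nil _, fun m X => ?_⟩
    simp only [IsEmpty.forall_iff, blockProj_true, mul_one]
    rfl
  | succ k ih =>
    obtain ⟨S, hS⟩ := ih fun t => f t.succ
    refine ⟨.cons _ (krausInstrument (ContinuousLinearMap.id ℂ _)
      (by rw [ContinuousLinearMap.adjoint_id]; rfl)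
      (fun m => blockProj H fun i => f 0 i = m) ?_) S, fun m X => ?_⟩
    · rw [← sum_blockProj (f 0)]
      refine Finset.sum_congr rfl fun m _ => ?_
      rw [adjoint_blockProj]
      change blockProj H _ * blockProj H _ = _
      simp only [blockProj_mul, and_self]
    · rw [outcomeTrace_cons_krausInstrument, hS, tr_conj_mul, adjoint_blockProj]
      change tr (X * (blockProj H _ * (blockProj H _ * blockProj H _))) = _
      rw [blockProj_mul, blockProj_mul]
      simp only [Fin.forall_fin_succ, Fin.tail]
      congr! 4
      tauto

/-- A measurement can be carried out by a sequence of instruments, the outcomes of which are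
functions of that of the measurement. -/
theorem exists_measurementSeq [Nonempty ι] {M : Type} [Fintype M] [DecidableEq M] (k : ℕ)
    (f : Fin (k + 1) → ι → M) (π : ι → Op H) (hpos : ∀ i, (π i).IsPositive) (hsum : ∑ i, π i = 1) :
    ∃ S : InstrumentSeq M (k + 1) H, ∀ m X, S.outcomeTrace m X =
      ∑ i, if ∀ t, f t i = m t then tr (π i * X) else 0 := by
  classical
  have : ∀ i, ∃ B : Op H, π i = star B * B := fun i =>
    CStarAlgebra.nonneg_iff_eq_star_mul_self.1
      ((ContinuousLinearMap.nonneg_iff_isPositive _).2 (hpos i))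
  choose B hB using this
  -- The Naimark isometry `x ↦ (B i x)`: block projections after `V` have the effects `π i`. The
  -- first instrument both dilates and measures `f 0`; the later ones only project.
  let V : H →L[ℂ] PiLp 2 fun _ : ι => H :=
    (PiLp.continuousLinearEquiv 2 ℂ fun _ : ι => H).symm.toContinuousLinearMap ∘L
      ContinuousLinearMap.pi B
  have hV : ∀ x i, V x i = B i x := fun _ _ => rfl
  have hVp : ∀ p : ι → Prop, adjoint V ∘L blockProj H p ∘L V = ∑ i, if p i then π i else 0 := by
    intro p
    ext x
    refine ext_inner_left ℂ fun y => ?_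
    simp only [ContinuousLinearMap.comp_apply, ContinuousLinearMap.adjoint_inner_right,
      PiLp.inner_apply, sum_apply, inner_sum, blockProj_apply, hV]
    refine Finset.sum_congr rfl fun i _ => ?_
    split_ifs
    · rw [hB, mul_apply_eq_comp, ContinuousLinearMap.star_eq_adjoint,
        ContinuousLinearMap.adjoint_inner_right]
    · simp
  let i₀ : ι := Classical.arbitrary ι
  -- An auxiliary isometry, the inclusion of one summand, needed only to witness complete
  -- positivity.
  let J : H →L[ℂ] PiLp 2 fun _ : ι => H :=
    (PiLp.continuousLinearEquiv 2 ℂ fun _ : ι => H).symm.toContinuousLinearMap ∘L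
      ContinuousLinearMap.pi fun i => if i = i₀ then ContinuousLinearMap.id ℂ H else 0
  have hJ : adjoint J ∘L J = ContinuousLinearMap.id ℂ H := by
    have hJa : ∀ x i, J x i = if i = i₀ then x else 0 := fun x i => by
      simp only [J]
      split_ifs with h <;> simp [h]
    ext x
    refine ext_inner_left ℂ fun y => ?_
    simp only [ContinuousLinearMap.comp_apply, ContinuousLinearMap.adjoint_inner_right,
      PiLp.inner_apply, hJa]
    rw [Finset.sum_eq_single i₀] <;> simp +contextual
  obtain ⟨S, hS⟩ := exists_projectiveSeq (H := H) k fun t => f t.succ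
  have hkraus : ∀ p q : ι → Prop, adjoint (blockProj H p ∘L V) ∘L (blockProj H q ∘L
      (blockProj H p ∘L V)) = ∑ i, if p i ∧ q i then π i else 0 := by
    intro p q
    refine Eq.trans ?_ ((hVp fun i => p i ∧ q i).trans (by congr!))
    rw [ContinuousLinearMap.adjoint_comp, adjoint_blockProj]
    change adjoint V ∘L (blockProj H p * (blockProj H q * blockProj H p)) ∘L V = _
    rw [blockProj_mul, blockProj_mul]
    congr! 4
    tauto
  refine ⟨.cons _ (krausInstrument J hJ (fun m => blockProj H (fun i => f 0 i = m) ∘L V) ?_) S,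
    fun m X => ?_⟩
  · have : ∀ m, adjoint (blockProj H (fun i => f 0 i = m) ∘L V) ∘L
        (blockProj H (fun i => f 0 i = m) ∘L V) = ∑ i, if f 0 i = m then π i else 0 := by
      intro m
      have := hkraus (fun i => f 0 i = m) (fun _ => True)
      rw [blockProj_true] at this
      simp only [and_true] at this
      exact this
    simp only [this]
    rw [Finset.sum_comm, ← hsum]
    simp
  · rw [outcomeTrace_cons_krausInstrument, hS, tr_conj_mul, hkraus, Finset.mul_sum, tr_sum]
    refine Finset.sum_congr rfl fun i _ => ?_
    by_cases h : ∀ t, f t i = m t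
    · rw [if_pos h, if_pos ⟨h 0, fun t => h t.succ⟩, tr_mul_comm]
    · rw [if_neg h, if_neg fun h' : f 0 i = m 0 ∧ ∀ t : Fin k, f t.succ i = Fin.tail m t =>
        h (Fin.forall_fin_succ.2 h'), mul_zero, tr_zero]

end MeasurementSeq

/-- The guesswork of a measurement is that of a sequential strategy. -/
theorem measurementGuessworks_subset {n : ℕ} {H : Type u} [NormedAddCommGroup H]
    [InnerProductSpace ℂ H] [CompleteSpace H] [FiniteDimensional ℂ H] {ρ : Fin n → Op H}
    (hρ : IsEnsemble ρ) (γ : Fin n → ℝ) :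
    measurementGuessworks γ ρ ⊆ sequentialGuessworks γ ρ := by
  classical
  rintro g ⟨π, hπ, rfl⟩
  obtain _ | k := n
  · have := hρ.sum_trace
    simp at this
  obtain ⟨S, hS⟩ := exists_measurementSeq k (fun t (ν : Numbering (k + 1)) => ν t) π hπ.pos
    hπ.sum_eq_one
  have hq : ∀ t, seqQueryProb ρ S t = queryProb ρ π t := by
    intro t
    have : ∀ m, seqJointProb ρ S m t =
        ∑ ν : Numbering (k + 1), if m = ν then (tr (π ν * ρ (ν t))).re else 0 := by
      intro m
      -- A numbering never repeats a query, so nothing is discarded; any other string of queries has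
      -- probability zero.
      by_cases hm : ∃ ν : Numbering (k + 1), m = ν
      · obtain ⟨ν, rfl⟩ := hm
        have hnew : ¬ ∃ s < t, ν s = ν t := by
          rintro ⟨s, hs, hst⟩
          exact hs.ne (ν.injective hst)
        rw [seqJointProb, if_neg hnew, hS, Complex.re_sum]
        refine Finset.sum_congr rfl fun μ _ => ?_
        by_cases h : ν = μ
        · simp [h]
        · have h1 : ¬ ∀ t, μ t = ν t := fun h' => h (Equiv.ext fun t => (h' t).symm)
          have h2 : ¬ (ν : Fin (k + 1) → Fin (k + 1)) = μ := fun h' => h (DFunLike.coe_injective h')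
          rw [if_neg h1, if_neg h2, Complex.zero_re]
      · push Not at hm
        rw [Finset.sum_eq_zero fun ν _ => if_neg (hm ν)]
        unfold seqJointProb
        split_ifs
        · rfl
        · rw [hS, Finset.sum_eq_zero, Complex.zero_re]
          exact fun ν _ => if_neg fun h => hm ν (funext fun t => (h t).symm)
    simp only [seqQueryProb, this]
    rw [Finset.sum_comm]
    simp [queryProb]
  refine ⟨S, ?_, ?_⟩
  · simp only [hq, queryProb]
    rw [Finset.sum_comm]
    have : ∀ ν : Numbering (k + 1), ∑ t, (tr (π ν * ρ (ν t))).re = (tr (π ν * ∑ j, ρ j)).re := by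
      intro ν
      rw [Equiv.sum_comp ν fun j => (tr (π ν * ρ j)).re, Finset.mul_sum, tr_sum, Complex.re_sum]
    simp only [this]
    rw [← Complex.re_sum, ← tr_sum, ← Finset.sum_mul, hπ.sum_eq_one, one_mul, tr_sum,
      hρ.sum_trace, Complex.one_re]
  · simp only [seqGuesswork, guesswork, hq]

/-! ### Effective operators, the lower bound and its attainment -/

section Optimality

variable {n : ℕ} {H : Type u} [NormedAddCommGroup H] [InnerProductSpace ℂ H]

theorem average_eq (f : Fin n → ℝ) : average f = (n : ℝ)⁻¹ * ∑ i, f i := by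
  simp [average]

theorem sum_sub_average (γ : Fin n → ℝ) : ∑ t, (γ t - average γ) = 0 := by
  rcases Nat.eq_zero_or_pos n with rfl | hn
  · simp
  · have : (n : ℝ) ≠ 0 := by positivity
    rw [Finset.sum_sub_distrib, average_eq]
    simp [this]

theorem sum_smul_eq_effectiveOp (γ : Fin n → ℝ) (ρ : Fin n → Op H) (ν : Numbering n) :
    ∑ t, γ t • ρ (ν t) = (1 / 2 : ℝ) • effectiveOp γ ρ ν + average γ • ∑ j, ρ j := by
  rw [effectiveOp, smul_smul, ← Equiv.sum_comp ν ρ, Finset.smul_sum,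
    Finset.smul_sum, ← Finset.sum_add_distrib]
  refine Finset.sum_congr rfl fun t _ => ?_
  module

/-- Balancedness says that `γ - γ̄` changes sign under `σ`; reindexing time moves this sign onto the
operator. -/
theorem effectiveOp_mul {γ : Fin n → ℝ} {σ : Equiv.Perm (Fin n)} (hγ : IsBalancedBy γ σ)
    (ρ : Fin n → Op H) (ν : Numbering n) : effectiveOp γ ρ (ν * σ) = -effectiveOp γ ρ ν := by
  rw [effectiveOp, effectiveOp, ← smul_neg, ← Finset.sum_neg_distrib,
    ← Equiv.sum_comp σ fun t => -((γ t - average γ) • ρ (ν t))]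
  congr 1
  refine Finset.sum_congr rfl fun t _ => ?_
  have := hγ (σ t)
  rw [show σ⁻¹ (σ t) = t by simp] at this
  rw [Equiv.Perm.mul_apply, ← neg_smul]
  congr 1
  linarith

theorem tr_effectiveOp {ρ : Fin n → Op H} (hunif : ∀ m, tr (ρ m) = (n : ℂ)⁻¹) (γ : Fin n → ℝ)
    (ν : Numbering n) : tr (effectiveOp γ ρ ν) = 0 := by
  simp only [effectiveOp, tr_real_smul, tr_sum, hunif]
  rw [← Finset.sum_mul, ← Complex.ofReal_sum, sum_sub_average]
  simp

theorem isSelfAdjoint_effectiveOp [CompleteSpace H] {ρ : Fin n → Op H} (hρ : IsEnsemble ρ)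
    (γ : Fin n → ℝ) (ν : Numbering n) : IsSelfAdjoint (effectiveOp γ ρ ν) := by
  refine IsSelfAdjoint.smul (IsSelfAdjoint.all _) (isSelfAdjoint_sum _ fun t _ => ?_)
  exact IsSelfAdjoint.smul (IsSelfAdjoint.all _) (hρ.pos _).isSelfAdjoint

theorem pauliVector_sum_smul (τ : Fin 3 → Op H) {ι : Type*} [Fintype ι] (c : ι → ℝ)
    (A : ι → Op H) : pauliVector τ (∑ i, c i • A i) = ∑ i, c i • pauliVector τ (A i) := by
  ext k
  simp [pauliVector, Finset.sum_mul, tr_sum, tr_real_smul]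

theorem sum_pauliVector_eq (τ : Fin 3 → Op H) (ρ : Fin n → Op H) :
    ∑ j, pauliVector τ (ρ j) = (n : ℝ) • pauliVector τ (average ρ) := by
  rcases Nat.eq_zero_or_pos n with rfl | hn
  · simp
  · have hn' : (n : ℝ) ≠ 0 := by positivity
    rw [average, Finset.smul_sum, pauliVector_sum_smul, Finset.smul_sum]
    refine Finset.sum_congr rfl fun j _ => ?_
    rw [smul_smul, mul_inv_cancel₀ hn', one_smul]

theorem norm_sq_sum_smul_eq {ι : Type*} [Fintype ι] {F : Type*} [NormedAddCommGroup F]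
    [InnerProductSpace ℝ F] (c : ι → ℝ) (w : ι → F) :
    ‖∑ i, c i • w i‖ ^ 2 = ∑ i, ∑ j, c i * c j * Matrix.gram ℝ w i j := by
  rw [← real_inner_self_eq_norm_sq, sum_inner]
  refine Finset.sum_congr rfl fun i _ => ?_
  rw [inner_sum]
  refine Finset.sum_congr rfl fun j _ => ?_
  rw [real_inner_smul_left, real_inner_smul_right, Matrix.gram_apply, mul_assoc]

/-- The numbering built from the benevolent arrangement maximizes the effective Pauli vector. -/
theorem norm_pauliVector_effectiveOp_le (τ : Fin 3 → Op H) (γ : Fin n → ℝ) (ρ : Fin n → Op H)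
    (hconst : ∀ m m' : Fin n,
      inner ℝ (pauliVector τ (average ρ)) (pauliVector τ (ρ m)) =
        inner ℝ (pauliVector τ (average ρ)) (pauliVector τ (ρ m')))
    (σ₁ σ₂ : Equiv.Perm (Fin n)) (hσ₁ : Monotone (γ ∘ σ₁))
    (hσ₂ : IsBenevolent (-Matrix.gram ℝ (pauliVector τ ∘ ρ ∘ σ₂))) (ν : Numbering n) :
    ‖pauliVector τ (effectiveOp γ ρ ν)‖ ≤
      ‖pauliVector τ (effectiveOp γ ρ (σ₂ * bvNumbering n * σ₁⁻¹))‖ := by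
  set w : Fin n → EuclideanSpace ℝ (Fin 3) := pauliVector τ ∘ ρ ∘ σ₂ with hw
  let g : Fin n → ℝ := fun t => 2 * (γ (σ₁ t) - average γ)
  have hg : Monotone g := fun s t hst => by
    have : γ (σ₁ s) ≤ γ (σ₁ t) := hσ₁ hst
    simp only [g]
    linarith
  -- Costs in increasing order and states in benevolent order: the numbering becomes the permutation
  -- `σ₁⁻¹ ν⁻¹ σ₂`, which is the inverse of `bvNumbering n` at the claimed optimum.
  have hv : ∀ ν : Numbering n, pauliVector τ (effectiveOp γ ρ ν) =
      ∑ x, g ((σ₁⁻¹ * ν⁻¹ * σ₂) x) • w x := by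
    intro ν
    rw [effectiveOp, Finset.smul_sum]
    simp only [smul_smul]
    rw [pauliVector_sum_smul, ← Equiv.sum_comp (ν⁻¹ * σ₂)]
    refine Finset.sum_congr rfl fun x _ => ?_
    simp [g, hw]
  have hrow : ∀ i i', ∑ j, Matrix.gram ℝ w i j = ∑ j, Matrix.gram ℝ w i' j := by
    have : ∀ i, ∑ j, Matrix.gram ℝ w i j =
        n * inner ℝ (pauliVector τ (average ρ)) (pauliVector τ (ρ (σ₂ i))) := fun i => by
      simp only [Matrix.gram_apply]
      rw [← inner_sum]
      simp only [hw, Function.comp_apply]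
      rw [Equiv.sum_comp σ₂ fun j => pauliVector τ (ρ j), sum_pauliVector_eq,
        real_inner_smul_right, real_inner_comm]
    intro i i'
    rw [this, this, hconst]
  -- The constant Toeplitz diagonal makes all Pauli vectors equally long; then Cauchy–Schwarz
  -- applies.
  have hdiag : ∀ x y, Matrix.gram ℝ w x y ≤ Matrix.gram ℝ w x x := fun x y => by
    have h1 := hσ₂.toeplitz x x y y (by simp)
    simp only [Matrix.neg_apply, Matrix.gram_apply, neg_inj, real_inner_self_eq_norm_sq] at h1
    have h2 : ‖w x‖ = ‖w y‖ := (sq_eq_sq₀ (norm_nonneg _) (norm_nonneg _)).1 h1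
    rw [Matrix.gram_apply, Matrix.gram_apply, real_inner_self_eq_norm_sq, sq]
    exact (real_inner_le_norm _ _).trans_eq (by rw [h2])
  have key := circular_rearrangement (Matrix.gram ℝ w) (hσ₂.antitone_cyclicDist hrow hdiag) hg
    (σ₁⁻¹ * ν⁻¹ * σ₂)
  have hu : σ₁⁻¹ * (σ₂ * bvNumbering n * σ₁⁻¹)⁻¹ * σ₂ = (bvNumbering n)⁻¹ := by group
  rw [← sq_le_sq₀ (norm_nonneg _) (norm_nonneg _), hv, hv, hu, norm_sq_sum_smul_eq,
    norm_sq_sum_smul_eq]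
  exact key

variable [CompleteSpace H]

/-- The `√2` arises because the scalar is `Tr(E²) / 2`, while Parseval gives the squared length as
`Tr(E²)`. -/
theorem effectiveOp_mul_self (hH : Module.finrank ℂ H = 2) {τ : Fin 3 → Op H}
    (hτ : IsPauliBasis τ) {ρ : Fin n → Op H} (hρ : IsEnsemble ρ)
    (hunif : ∀ m, tr (ρ m) = (n : ℂ)⁻¹) (γ : Fin n → ℝ) (ν : Numbering n) :
    effectiveOp γ ρ ν * effectiveOp γ ρ ν =
      (‖pauliVector τ (effectiveOp γ ρ ν)‖ / √2) ^ 2 • (1 : Op H) := by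
  rw [mul_self_eq_smul_one hH (tr_effectiveOp hunif γ ν),
    hτ.tr_mul_self hH (tr_effectiveOp hunif γ ν) (isSelfAdjoint_effectiveOp hρ γ ν),
    ← Complex.coe_smul, div_pow, Real.sq_sqrt (by norm_num)]
  push_cast
  rfl

omit [CompleteSpace H] in
/-- A bound from below of the effective operators bounds the guesswork. -/
theorem average_sub_le_of_functional [FiniteDimensional ℂ H] (hH : Module.finrank ℂ H = 2)
    {ι : Type*} [Fintype ι] {φ : ι → (Op H →ₗ[ℂ] ℂ)}
    (hφ : ∀ i X, X.IsPositive → 0 ≤ (φ i X).re) (hsum : ∀ X, ∑ i, φ i X = tr X)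
    {ρ : Fin n → Op H} (hρ : IsEnsemble ρ) (ν : ι → Numbering n) (γ : Fin n → ℝ) {l : ℝ}
    (hl : ∀ ν, (l • (1 : Op H) + effectiveOp γ ρ ν).IsPositive) :
    average γ - l ≤ ∑ i, ∑ t, γ t * (φ i (ρ (ν i t))).re := by
  have hsmul : ∀ i (c : ℝ) X, (φ i (c • X)).re = c * (φ i X).re := fun i c X => by
    rw [← Complex.coe_smul, map_smul]
    simp
  have h1 : ∀ i, ∑ t, γ t * (φ i (ρ (ν i t))).re =
      1 / 2 * (φ i (effectiveOp γ ρ (ν i))).re + average γ * (φ i (∑ j, ρ j)).re := fun i => by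
    rw [← hsmul, ← hsmul, ← Complex.add_re, ← map_add, ← sum_smul_eq_effectiveOp, map_sum,
      Complex.re_sum]
    simp only [hsmul]
  have h2 : ∀ i, -l * (φ i 1).re ≤ (φ i (effectiveOp γ ρ (ν i))).re := fun i => by
    have := hφ i _ (hl (ν i))
    rw [map_add, Complex.add_re, hsmul] at this
    linarith
  simp only [h1]
  have h3 : ∑ i, average γ * (φ i (∑ j, ρ j)).re = average γ := by
    rw [← Finset.mul_sum, ← Complex.re_sum, hsum, tr_sum, hρ.sum_trace]
    simp
  -- The dimension two compensates the factor `1 / 2` in front of the effective operator.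
  have h4 : ∑ i, (φ i 1).re = 2 := by
    rw [← Complex.re_sum, hsum, tr_one, hH]
    simp
  rw [Finset.sum_add_distrib, h3, ← Finset.mul_sum]
  have h5 := Finset.sum_le_sum fun i (_ : i ∈ Finset.univ) => h2 i
  rw [← Finset.mul_sum, h4] at h5
  linarith

variable [FiniteDimensional ℂ H] {γ : Fin n → ℝ} {σ : Equiv.Perm (Fin n)}

omit [FiniteDimensional ℂ H] in
theorem helstromMeasurement_eq (ρ : Fin n → Op H) (νs ν : Numbering n) :
    helstromMeasurement γ σ ρ νs ν =
      if ν = νs ∨ ν = νs * σ then helstromEffect (effectiveOp γ ρ ν) else 0 := by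
  unfold helstromMeasurement helstromEffect
  congr!

omit [FiniteDimensional ℂ H] in
-- As `σ ≠ 1`, the two outcomes are distinct. A general `F` serves both the sum of effects and the
-- sum of traces.
theorem sum_helstromMeasurement (hσ : σ ≠ 1) (ρ : Fin n → Op H) (νs : Numbering n)
    {V : Type*} [AddCommMonoid V] (F : Op H → Numbering n → V) (hF : ∀ ν, F 0 ν = 0) :
    ∑ ν, F (helstromMeasurement γ σ ρ νs ν) ν =
      F (helstromEffect (effectiveOp γ ρ νs)) νs +
        F (helstromEffect (effectiveOp γ ρ (νs * σ))) (νs * σ) := by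
  have hne : νs ≠ νs * σ := fun h => hσ (by simpa using h)
  rw [← Finset.sum_subset (Finset.subset_univ {νs, νs * σ}), Finset.sum_pair hne]
  · simp [helstromMeasurement_eq]
  · intro ν _ hν
    rw [helstromMeasurement_eq, if_neg (by simpa using hν), hF]

theorem isNumberingMeasurement_helstromMeasurement (hγ : IsBalancedBy γ σ) (hσ : σ ≠ 1)
    {ρ : Fin n → Op H} (hρ : IsEnsemble ρ) (νs : Numbering n) :
    IsNumberingMeasurement (helstromMeasurement γ σ ρ νs) where
  pos ν := by
    rw [helstromMeasurement_eq]
    split_ifs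
    · exact isPositive_helstromEffect _
    · exact ContinuousLinearMap.isPositive_zero
  sum_eq_one := by
    rw [sum_helstromMeasurement hσ ρ νs (fun A _ => A) fun _ => rfl, effectiveOp_mul hγ]
    exact helstromEffect_add_neg (isSelfAdjoint_effectiveOp hρ γ νs)

omit [CompleteSpace H] [FiniteDimensional ℂ H] in
theorem guesswork_eq_sum (γ : Fin n → ℝ) (ρ : Fin n → Op H) (π : Numbering n → Op H) :
    guesswork γ ρ π = ∑ ν, ∑ t, γ t * (tr (π ν * ρ (ν t))).re := by
  simp only [guesswork, queryProb, Finset.mul_sum]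
  exact Finset.sum_comm

/-- Each of the two outcomes gives `Tr[(E - l) / 2] = -l`, with `E` replaced by `-E` for the second
one. -/
theorem guesswork_helstromMeasurement (hH : Module.finrank ℂ H = 2) (hγ : IsBalancedBy γ σ)
    (hσ : σ ≠ 1) {ρ : Fin n → Op H} (hρ : IsEnsemble ρ) (hunif : ∀ m, tr (ρ m) = (n : ℂ)⁻¹)
    (νs : Numbering n) {l : ℝ} (hl : 0 ≤ l)
    (hE : effectiveOp γ ρ νs * effectiveOp γ ρ νs = l ^ 2 • (1 : Op H)) :
    guesswork γ ρ (helstromMeasurement γ σ ρ νs) = average γ - l := by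
  set π := helstromMeasurement γ σ ρ νs with hπ
  have hpi := isNumberingMeasurement_helstromMeasurement hγ hσ hρ νs
  have h1 : ∀ ν, ∑ t, γ t * (tr (π ν * ρ (ν t))).re =
      1 / 2 * (tr (π ν * effectiveOp γ ρ ν)).re + average γ * (tr (π ν * ∑ j, ρ j)).re := fun ν => by
    have := congrArg (fun A => (tr (π ν * A)).re) (sum_smul_eq_effectiveOp γ ρ ν)
    simpa [Finset.mul_sum, mul_add, tr_add, tr_sum, tr_real_smul] using this
  have h2 : ∑ ν, (tr (π ν * ∑ j, ρ j)).re = 1 := by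
    rw [← Complex.re_sum, ← tr_sum, ← Finset.sum_mul, hpi.sum_eq_one, one_mul, tr_sum,
      hρ.sum_trace, Complex.one_re]
  have htr : ∀ E : Op H, IsSelfAdjoint E → tr E = 0 → E * E = l ^ 2 • (1 : Op H) →
      (tr (helstromEffect E * E)).re = -l := by
    intro E hs ht h
    rw [helstromEffect_mul hs hl h, tr_real_smul, tr_sub, ht, tr_real_smul, tr_one, hH]
    simp
    ring
  have hs := isSelfAdjoint_effectiveOp hρ γ νs
  have ht := tr_effectiveOp hunif γ νs
  have h3 : ∑ ν, (tr (π ν * effectiveOp γ ρ ν)).re = -l + -l := by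
    rw [hπ, sum_helstromMeasurement hσ ρ νs (fun A ν => (tr (A * effectiveOp γ ρ ν)).re)
      fun ν => by simp [tr_zero], effectiveOp_mul hγ, htr _ hs ht hE,
      htr _ hs.neg (by rw [← effectiveOp_mul hγ]; exact tr_effectiveOp hunif γ _)
        (by rw [neg_mul_neg, hE])]
  rw [guesswork_eq_sum]
  simp only [h1]
  rw [Finset.sum_add_distrib, ← Finset.mul_sum, ← Finset.mul_sum, h2, h3]
  ring

end Optimality

end Guesswork

theorem mainTheorem4 {n : ℕ} {H : Type u} [NormedAddCommGroup H] [InnerProductSpace ℂ H]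
    [CompleteSpace H] [FiniteDimensional ℂ H] (hH : Module.finrank ℂ H = 2)
    (τ : Fin 3 → Guesswork.Op H) (hτ : Guesswork.IsPauliBasis τ)
    (γ : Fin n → ℝ) (σγ : Equiv.Perm (Fin n)) (hγ : Guesswork.IsBalancedBy γ σγ) (hσγ : σγ ≠ 1)
    (ρ : Fin n → Guesswork.Op H) (hρ : Guesswork.IsEnsemble ρ)
    (hunif : ∀ m, Guesswork.tr (ρ m) = (n : ℂ)⁻¹)
    (hconst : ∀ m m' : Fin n,
      inner ℝ (Guesswork.pauliVector τ (Guesswork.average ρ)) (Guesswork.pauliVector τ (ρ m)) =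
        inner ℝ (Guesswork.pauliVector τ (Guesswork.average ρ)) (Guesswork.pauliVector τ (ρ m')))
    (σ₁ σ₂ : Equiv.Perm (Fin n)) (hσ₁ : Monotone (γ ∘ σ₁))
    (hσ₂ : Guesswork.IsBenevolent (-Matrix.gram ℝ (Guesswork.pauliVector τ ∘ ρ ∘ σ₂))) :
    Guesswork.IsNumberingMeasurement (Guesswork.helstromMeasurement γ σγ ρ
        (σ₂ * Guesswork.bvNumbering n * σ₁⁻¹)) ∧
      Guesswork.IsMinGuesswork γ ρ (Guesswork.guesswork γ ρ (Guesswork.helstromMeasurement γ σγ ρ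
        (σ₂ * Guesswork.bvNumbering n * σ₁⁻¹))) ∧
      IsLeast (Guesswork.measurementGuessworks γ ρ)
        (Guesswork.guesswork γ ρ (Guesswork.helstromMeasurement γ σγ ρ
          (σ₂ * Guesswork.bvNumbering n * σ₁⁻¹))) := by
  set νs := σ₂ * Guesswork.bvNumbering n * σ₁⁻¹ with hνs
  have hl : 0 ≤ ‖Guesswork.pauliVector τ (Guesswork.effectiveOp γ ρ νs)‖ / √2 := by positivity
  have hsq := Guesswork.effectiveOp_mul_self hH hτ hρ hunif γ
  have hval := Guesswork.guesswork_helstromMeasurement hH hγ hσγ hρ hunif νs hl (hsq νs)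
  have hmeas := Guesswork.isNumberingMeasurement_helstromMeasurement hγ hσγ hρ νs
  -- Every `E ν` is bounded below by minus its own `l ν`, hence by minus the largest one, at `νs`.
  have hbound : ∀ ν, ((‖Guesswork.pauliVector τ (Guesswork.effectiveOp γ ρ νs)‖ / √2) •
      (1 : Guesswork.Op H) + Guesswork.effectiveOp γ ρ ν).IsPositive := by
    intro ν
    have h1 := Guesswork.isPositive_smul_one_add (Guesswork.isSelfAdjoint_effectiveOp hρ γ ν)
      (by positivity) (hsq ν)
    have h2 : ‖Guesswork.pauliVector τ (Guesswork.effectiveOp γ ρ ν)‖ / √2 ≤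
        ‖Guesswork.pauliVector τ (Guesswork.effectiveOp γ ρ νs)‖ / √2 := by
      gcongr
      exact Guesswork.norm_pauliVector_effectiveOp_le τ γ ρ hconst σ₁ σ₂ hσ₁ hσ₂ ν
    rw [← ContinuousLinearMap.nonneg_iff_isPositive] at h1 ⊢
    refine h1.trans ?_
    gcongr
  have hseq : ∀ g ∈ Guesswork.sequentialGuessworks γ ρ,
      Guesswork.guesswork γ ρ (Guesswork.helstromMeasurement γ σγ ρ νs) ≤ g := by
    rintro g ⟨S, hS, rfl⟩
    obtain ⟨φ, ν, hpos, hsum, hS'⟩ := Guesswork.exists_functional_numbering hρ S hS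
    rw [hval, hS']
    exact Guesswork.average_sub_le_of_functional hH hpos hsum hρ ν γ hbound
  have hmem : Guesswork.guesswork γ ρ (Guesswork.helstromMeasurement γ σγ ρ νs) ∈
      Guesswork.measurementGuessworks γ ρ := ⟨_, hmeas, rfl⟩
  have hsub := Guesswork.measurementGuessworks_subset hρ γ
  exact ⟨hmeas, ⟨hsub hmem, hseq⟩, hmem, fun g hg => hseq g (hsub hg)⟩
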